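/- Fix finite sets of constructor names $C$, destructor names $D$ and function names $g$, and a finite set of priorities (odd for constructors, even for records and destructors). **Values.** The set $\mathcal V$ of values is given coinductively by $v ::= \bot \mid C^p v \mid \{D_1=v_1;\dots;D_k=v_k\}^p$ ($k\ge 0$), ordered by making $\bot$ least and constructors and records monotone. A value is total if no finite branch of it ends with $\bot$ and, on each infinite branch, the largest priority occurring infinitely often is even. Let $\mathcal A$ be the Smyth power domain of $\mathcal V$ with the empty sum $0$ allowed: its elements are the finitely generated sums of values, identified when they have the same upward closure, and $U\le V$ iff $V^{\uparrow}\subseteq U^{\uparrow}$; thus $0$ is the greatest element and $+$ is the greatest lower bound. An element of $\mathcal A$ is total if all its summands are, and a function $\mathcal A\to\mathcal A$ is total if it sends total elements to total elements. Let $\boxtimes :\mathcal A\to\mathcal A$ be the map with $\boxtimes (0)=0$ and $\boxtimes (v)=\bot$ for $v\neq 0$. **Terms.** Terms are generated by $$t ::= C^p t \mid \{D_1=t_1;\dots;D_n=t_n\}^p \mid C^{p-} t \mid D^p t \mid x \mid \boxtimes \{t_1,\dots,t_n\} \mid f\,t \mid g\,t \mid 0,$$ where $f$ is a distinguished function name and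 $g$ ranges over the other ones. Fix an environment $\rho$ that interprets each $g$ by a total Scott-continuous function $\rho(g):\mathcal A\to\mathcal A$ with $\rho(g)(0)=0$. Given $\varphi:\mathcal A\to\mathcal A$, a term $t$ is interpreted by a function $[\![t]\!](\varphi):\mathcal A\to\mathcal A$: $x$ is the identity, $f$ is interpreted by $\varphi$ and $g$ by $\rho(g)$; constructors and records are (multi)linear; $C^{p-}$ and $D^p$ are linear and map $\bot$ to $\bot$, $C^p u$ (resp. $\{\dots;D=u;\dots\}^p$) to $u$, and every other value to $0$; $\boxtimes \{t_1,\dots,t_n\}$ takes the value $0$ if the argument or the value of some $t_i$ is $0$, and $\bot$ otherwise; the empty record sends $0$ to $0$ and every other argument to $\{\}$; $0$ is the constant $0$. A finite sum $T=t_1+\dots+t_n$ of terms defines the operator $[\![T]\!](\varphi)=\sum_i[\![t_i]\!](\varphi)$ (pointwise), and $\mathrm{fix}(T)=\bigvee_{n\ge0}[\![T]\!]^n(\boxtimes ):\mathcal A\to\mathcal A$. **Call-graph.** For a finite sum $T$ of terms that do not contain $\boxtimes $, let $$G(T)=\sum_{\beta f u\in T}\beta^{\boxtimes}\,f\,u^{\boxtimes},$$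 where the sum ranges over all occurrences, in the summands of $T$, of a subterm $f\,u$ at a position $\beta$. Here $\beta$ is the branch leading to that subterm (each record on it being restricted to the one field that the branch goes through), and $\beta^{\boxtimes}$, $u^{\boxtimes}$ are obtained from $\beta$, $u$ by replacing all function names ($f$ and every $g$) by $\boxtimes $. **Proposition.** Let $T$ be a finite sum of terms (in particular, of simple terms, i.e. terms different from $0$) that do not contain $\boxtimes $. If $\mathrm{fix}(G(T))$ is total, then $\mathrm{fix}(T)$ is total. -/

import Mathlib

namespace SizeChange

noncomputable section

/-! ### Values -/

/-- Priorities of constructors: the odd elements of the finite set `P`. -/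
abbrev OddPrio (P : Finset ℕ) : Type := {p : ℕ // p ∈ P ∧ Odd p}

/-- Priorities of records and destructors: the even elements of the finite set `P`. -/
abbrev EvenPrio (P : Finset ℕ) : Type := {p : ℕ // p ∈ P ∧ Even p}

/-- Root symbols of values. -/
inductive Shape (C D : Type*) (P : Finset ℕ) : Type _
  | bot : Shape C D P
  | con (c : C) (p : OddPrio P) : Shape C D P
  | record (p : EvenPrio P) (F : Finset D) : Shape C D P

/-- Positions directly below a root symbol. -/
def Arity {C D : Type*} {P : Finset ℕ} : Shape C D P → Type _
  | .bot => PEmpty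
  | .con _ _ => PUnit
  | .record _ F => {d : D // d ∈ F}

/-- The signature functor of values. -/
def ValueF (C D : Type*) (P : Finset ℕ) : PFunctor := ⟨Shape C D P, Arity⟩

/-- Values `v ::= ⊥ | C^p v | {D₁ = v₁; …; D_k = v_k}^p`, coinductively. -/
def Value (C D : Type*) (P : Finset ℕ) : Type _ := PFunctor.M (ValueF C D P)

namespace Value

variable {C D : Type*} {P : Finset ℕ}

/-- The undefined value. -/
def bot : Value C D P := PFunctor.M.mk ⟨Shape.bot, PEmpty.elim⟩

/-- The value `C^p v`. -/
def con (c : C) (p : OddPrio P) (v : Value C D P) : Value C D P :=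
  PFunctor.M.mk ⟨Shape.con c p, fun _ => v⟩

/-- The value `{D = x D ; D ∈ F}^p`. -/
def record (p : EvenPrio P) (F : Finset D) (x : {d : D // d ∈ F} → Value C D P) :
    Value C D P :=
  PFunctor.M.mk ⟨Shape.record p F, x⟩

/-- `R` is a simulation for the order "`⊥` is least, and constructors and records are monotone". -/
def IsSimulation (R : Value C D P → Value C D P → Prop) : Prop :=
  ∀ u v, R u v →
    u = bot ∨
    (∃ c p u' v', u = con c p u' ∧ v = con c p v' ∧ R u' v') ∨
    (∃ p F x y, u = record p F x ∧ v = record p F y ∧ ∀ d, R (x d) (y d))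

/-- The order on values: the greatest simulation. -/
instance : LE (Value C D P) := ⟨fun u v => ∃ R, IsSimulation R ∧ R u v⟩

/-- Finite values. -/
inductive IsFinite : Value C D P → Prop
  | bot : IsFinite bot
  | con (c : C) (p : OddPrio P) (v : Value C D P) : IsFinite v → IsFinite (con c p v)
  | record (p : EvenPrio P) (F : Finset D) (x : {d : D // d ∈ F} → Value C D P) :
      (∀ d, IsFinite (x d)) → IsFinite (record p F x)

/-- `Step v p w`: the root of `v` has priority `p` and `w` is directly below it. -/
inductive Step : Value C D P → ℕ → Value C D P → Prop
  | con (c : C) (p : OddPrio P) (v : Value C D P) : Step (con c p v) p v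
  | record (p : EvenPrio P) (F : Finset D) (x : {d : D // d ∈ F} → Value C D P)
      (d : {d : D // d ∈ F}) : Step (record p F x) p (x d)

/-- `p` is the principal priority of a sequence: the largest one occurring infinitely often. -/
def IsPrincipal (π : ℕ → ℕ) (p : ℕ) : Prop :=
  (∃ᶠ n in Filter.atTop, π n = p) ∧ ∀ q, (∃ᶠ n in Filter.atTop, π n = q) → q ≤ p

/-- A value is total when no finite branch ends with `⊥` and every infinite branch has an even
principal priority. -/
def Total (v : Value C D P) : Prop :=
  (¬ Relation.ReflTransGen (fun u w => ∃ p, Step u p w) v bot) ∧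
  ∀ (b : ℕ → Value C D P) (π : ℕ → ℕ), b 0 = v → (∀ n, Step (b n) (π n) (b (n + 1))) →
    ∃ p, Even p ∧ IsPrincipal π p

end Value

/-! ### Values with approximations: Smyth power domain with the empty sum -/

/-- The upward closure of a set of values. -/
def up {C D : Type*} {P : Finset ℕ} (K : Set (Value C D P)) : Set (Value C D P) :=
  {v | ∃ k ∈ K, k ≤ v}

/-- Elements of the domain `𝒜`, as sums of values, each represented by the upward closure of its
set of summands. Compact elements are the (possibly empty) finite sums of finite values, least upper
bounds are intersections, and every element is the least upper bound of compact ones. (Finite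
suprema of compact elements are compact, so the family needs not be required to be directed.) -/
structure Approx (C D : Type*) (P : Finset ℕ) where
  /-- The (upward closed) set of summands. -/
  carrier : Set (Value C D P)
  /-- The set of summands is finitely generated. -/
  finGen : ∃ 𝒦 : Set (Set (Value C D P)),
    (∀ K ∈ 𝒦, K.Finite ∧ ∀ k ∈ K, k.IsFinite) ∧ carrier = ⋂ K ∈ 𝒦, up K

namespace Approx

variable {C D : Type*} {P : Finset ℕ}

theorem ext_carrier {U V : Approx C D P} (h : U.carrier = V.carrier) : U = V := by
  cases U; cases V; simp_all

/-- `U ≤ V` iff `V↑ ⊆ U↑`. -/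
instance : PartialOrder (Approx C D P) where
  le U V := V.carrier ⊆ U.carrier
  le_refl _ := Set.Subset.rfl
  le_trans _ _ _ h h' := h'.trans h
  le_antisymm _ _ h h' := ext_carrier (h'.antisymm h)

theorem finGen_sInter (s : Set (Approx C D P)) :
    ∃ 𝒦 : Set (Set (Value C D P)),
      (∀ K ∈ 𝒦, K.Finite ∧ ∀ k ∈ K, k.IsFinite) ∧ (⋂ U ∈ s, U.carrier) = ⋂ K ∈ 𝒦, up K := by
  refine ⟨⋃ U ∈ s, U.finGen.choose, ?_, ?_⟩
  · intro K hK
    simp only [Set.mem_iUnion] at hK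
    obtain ⟨U, -, hU⟩ := hK
    exact U.finGen.choose_spec.1 K hU
  · ext v
    have key : ∀ U : Approx C D P, v ∈ U.carrier ↔ ∀ K ∈ U.finGen.choose, v ∈ up K := by
      intro U
      conv_lhs => rw [U.finGen.choose_spec.2]
      simp only [Set.mem_iInter]
    simp only [Set.mem_iInter, Set.mem_iUnion, key]
    exact ⟨fun h K ⟨U, hU, hK⟩ => h U hU K hK, fun h U hU K hK => h K ⟨U, hU, hK⟩⟩

/-- Least upper bounds are intersections. -/
instance : SupSet (Approx C D P) := ⟨fun s => ⟨⋂ U ∈ s, U.carrier, finGen_sInter s⟩⟩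

theorem isLUB_sSup' (s : Set (Approx C D P)) : IsLUB s (sSup s) :=
  ⟨fun _ hU => Set.biInter_subset_of_mem hU, fun _ hV => Set.subset_iInter₂ fun _ hU => hV hU⟩

/-- `⊤` is the empty sum `0`, `⊥` is the sum of all values and `⊓` is the sum. -/
instance : CompleteLattice (Approx C D P) := completeLatticeOfSup _ isLUB_sSup'

theorem carrier_top : (⊤ : Approx C D P).carrier = ∅ := by
  let E : Approx C D P := ⟨∅, {∅}, by simp, by simp [up]⟩
  have h : E ≤ ⊤ := le_top
  exact Set.subset_empty_iff.mp h

theorem carrier_bot : (⊥ : Approx C D P).carrier = Set.univ := by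
  let E : Approx C D P := ⟨Set.univ, ∅, by simp, by simp⟩
  have h : ⊥ ≤ E := bot_le
  exact Set.univ_subset_iff.mp h

/-- The formal sum of a set of values: the greatest element of `𝒜` having all of them as
summands. -/
def sum (X : Set (Value C D P)) : Approx C D P := sSup {U | X ⊆ U.carrier}

/-- A sum of values is total when all its summands are. In particular, `0` is total. -/
def Total (U : Approx C D P) : Prop := ∀ v ∈ U.carrier, v.Total

/-- `C^p (∑ v) = ∑ C^p v`. -/
def con (c : C) (p : OddPrio P) (U : Approx C D P) : Approx C D P :=
  sum {v | ∃ u ∈ U.carrier, v = Value.con c p u}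

/-- Records are multilinear. -/
def record (p : EvenPrio P) (F : Finset D) (U : {d : D // d ∈ F} → Approx C D P) :
    Approx C D P :=
  sum {v | ∃ x : {d : D // d ∈ F} → Value C D P,
    (∀ d, x d ∈ (U d).carrier) ∧ v = Value.record p F x}

/-- `C^p⁻`, linear, with `⊥ ↦ ⊥`, `C^p u ↦ u` and every other value mapped to `0`. -/
def uncon (c : C) (p : OddPrio P) (U : Approx C D P) : Approx C D P :=
  sum {u | Value.bot ∈ U.carrier ∨ Value.con c p u ∈ U.carrier}

/-- `D^p`, linear, with `⊥ ↦ ⊥`, `{…; D = u; …}^p ↦ u` and every other value mapped to `0`. -/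
def proj (d : D) (p : EvenPrio P) (U : Approx C D P) : Approx C D P :=
  sum {u | Value.bot ∈ U.carrier ∨
    ∃ (F : Finset D) (x : {d : D // d ∈ F} → Value C D P) (h : d ∈ F),
      Value.record p F x ∈ U.carrier ∧ u = x ⟨d, h⟩}

open Classical in
/-- The least function preserving `0`. -/
def daimon (U : Approx C D P) : Approx C D P := if U = ⊤ then ⊤ else ⊥

end Approx

/-- A function on `𝒜` is total when it sends total elements to total elements. -/
def TotalFun {C D : Type*} {P : Finset ℕ} (φ : Approx C D P → Approx C D P) : Prop :=
  ∀ U, U.Total → (φ U).Total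

/-- `fix(φ) = ⨆ₙ φⁿ(⊠)`, for an operator `φ` on functions from `𝒜` to itself. -/
def fix {C D : Type*} {P : Finset ℕ}
    (φ : (Approx C D P → Approx C D P) → Approx C D P → Approx C D P) :
    Approx C D P → Approx C D P :=
  ⨆ n : ℕ, φ^[n] Approx.daimon

/-! ### Terms -/

/-- Terms. The name `f` of the function being defined is kept apart (`self`) from the names of the
other functions (`call g`). -/
inductive Term (C D N : Type*) (P : Finset ℕ) : Type _
  | con (c : C) (p : OddPrio P) (t : Term C D N P) : Term C D N P
  | record (p : EvenPrio P) (F : Finset D) (t : {d : D // d ∈ F} → Term C D N P) : Term C D N P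
  | uncon (c : C) (p : OddPrio P) (t : Term C D N P) : Term C D N P
  | proj (d : D) (p : EvenPrio P) (t : Term C D N P) : Term C D N P
  | x : Term C D N P
  | daimon (n : ℕ) (θ : Fin n → Term C D N P) : Term C D N P
  | call (g : N) (t : Term C D N P) : Term C D N P
  | self (t : Term C D N P) : Term C D N P
  | zero : Term C D N P

/-- The symbols met along a branch; `field p d` is a record `{d = _}^p` with a single field. -/
inductive Frame (C D N : Type*) (P : Finset ℕ) : Type _
  | con (c : C) (p : OddPrio P) : Frame C D N P
  | field (p : EvenPrio P) (d : D) : Frame C D N P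
  | uncon (c : C) (p : OddPrio P) : Frame C D N P
  | proj (d : D) (p : EvenPrio P) : Frame C D N P
  | daimon : Frame C D N P
  | call (g : N) : Frame C D N P
  | self : Frame C D N P

variable {C D N : Type*} {P : Finset ℕ}

/-- Put a term below one symbol. -/
def Frame.app : Frame C D N P → Term C D N P → Term C D N P
  | .con c p, t => .con c p t
  | .field p d, t => .record p {d} fun _ => t
  | .uncon c p, t => .uncon c p t
  | .proj d p, t => .proj d p t
  | .daimon, t => .daimon 1 fun _ => t
  | .call g, t => .call g t
  | .self, t => .self t

/-- Replace a function name by `⊠`. -/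
def Frame.box : Frame C D N P → Frame C D N P
  | .call _ => .daimon
  | .self => .daimon
  | φ => φ

/-- A branch, from the root downwards. -/
abbrev Branch (C D N : Type*) (P : Finset ℕ) : Type _ := List (Frame C D N P)

/-- The term `β t`. -/
def Branch.app (β : Branch C D N P) (t : Term C D N P) : Term C D N P :=
  β.foldr Frame.app t

/-- `β^⊠`: all function names of `β` are replaced by `⊠`. -/
def Branch.box (β : Branch C D N P) : Branch C D N P := β.map Frame.box

namespace Term

/-- `t` does not contain `⊠`. -/
def DaimonFree : Term C D N P → Prop
  | con _ _ t => t.DaimonFree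
  | record _ _ t => ∀ d, (t d).DaimonFree
  | uncon _ _ t => t.DaimonFree
  | proj _ _ t => t.DaimonFree
  | x => True
  | daimon _ _ => False
  | call _ t => t.DaimonFree
  | self t => t.DaimonFree
  | zero => True

/-- `t^⊠`: all function names of `t` are replaced by `⊠`. -/
def box : Term C D N P → Term C D N P
  | con c p t => con c p t.box
  | record p F t => record p F fun d => (t d).box
  | uncon c p t => uncon c p t.box
  | proj d p t => proj d p t.box
  | x => x
  | daimon n θ => daimon n fun i => (θ i).box
  | call _ t => daimon 1 fun _ => t.box
  | self t => daimon 1 fun _ => t.box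
  | zero => zero

/-- All pairs `(β, u)` such that the subterm `f u` occurs in `t` at position `β`. -/
def occ : Term C D N P → List (Branch C D N P × Term C D N P)
  | con c p t => t.occ.map fun o => (.con c p :: o.1, o.2)
  | record p F t => F.attach.toList.flatMap fun d =>
      (t d).occ.map fun o => (.field p d :: o.1, o.2)
  | uncon c p t => t.occ.map fun o => (.uncon c p :: o.1, o.2)
  | proj d p t => t.occ.map fun o => (.proj d p :: o.1, o.2)
  | x => []
  | daimon n θ => (List.finRange n).flatMap fun i =>
      (θ i).occ.map fun o => (.daimon :: o.1, o.2)
  | call g t => t.occ.map fun o => (.call g :: o.1, o.2)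
  | self t => ([], t) :: t.occ.map fun o => (.self :: o.1, o.2)
  | zero => []

open Classical in
/-- The function `⟦t⟧` on `𝒜`, where `ρ` interprets the other function names and `φ` interprets `f`.
All functions are required to preserve `0`, whence the explicit test on `0` in the two cases (a
record without fields, and `⊠` without arguments) where this is not automatic. -/
def sem (ρ : N → Approx C D P → Approx C D P) (φ : Approx C D P → Approx C D P) :
    Term C D N P → Approx C D P → Approx C D P
  | con c p t, U => Approx.con c p (t.sem ρ φ U)
  | record p F t, U => if U = ⊤ then ⊤ else Approx.record p F fun d => (t d).sem ρ φ U
  | uncon c p t, U => Approx.uncon c p (t.sem ρ φ U)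
  | proj d p t, U => Approx.proj d p (t.sem ρ φ U)
  | x, U => U
  | daimon _ θ, U => if U = ⊤ ∨ ∃ i, (θ i).sem ρ φ U = ⊤ then ⊤ else ⊥
  | call g t, U => ρ g (t.sem ρ φ U)
  | self t, U => φ (t.sem ρ φ U)
  | zero, _ => ⊤

end Term

/-- The operator `⟦T⟧` defined by a finite sum `T` of terms; sums in `𝒜` are infima. -/
def semSum (ρ : N → Approx C D P → Approx C D P) (T : List (Term C D N P))
    (φ : Approx C D P → Approx C D P) (U : Approx C D P) : Approx C D P :=
  ⨅ t ∈ T, t.sem ρ φ U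

/-- The call-graph `G(T)`: the sum of the `β^⊠ f u^⊠`, over all occurrences `β f u` of `f`
in `T`. -/
def callGraph (T : List (Term C D N P)) : List (Term C D N P) :=
  T.flatMap fun t => t.occ.map fun o => o.1.box.app (.self o.2.box)

end

end SizeChange

/-!
The proof is by contraposition, and follows a single branch. Write `ψ = fix(T)`, and suppose that
`U` is total and that some `v ∈ ψ(U)` is not. Then `v` has a *bad branch* `l`, either ending with
`⊥` or with an odd principal priority. It is itself a value, in which all records have exactly one
field (`Value.exists_bad_branch`). The claim is that this very `l` belongs to `fix(G(T))(U)`, which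
is therefore not total either.

Since `ψ ≥ ⟦T⟧(ψ)` (`semSum_fix_le`), the value `v` belongs to `⟦t⟧(ψ)(U)` for some `t ∈ T`. One
follows `l` down the term `t` (`exists_factors`). It cannot reach the variable, as `U` is total. At
a function name whose argument is not total, one switches to a bad branch of the argument; this
happens at every `g`, since `g` is total, and it is harmless because `⊠` sends any nonzero argument
to `⊥`, which has all values as summands. Hence the path reaches an occurrence `β f u` for which `u(U)`
is total while `ψ(u(U))` has a value with a bad branch `l'` such that `l ∈ β^⊠(l')`. By induction on
`n`, `l'` belongs to `G(T)ⁿ(⊠)(u(U))`, which is included in `G(T)ⁿ(⊠)(u^⊠(U))` as `⊠` is the least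
function preserving `0` (`Term.sem_box_le`), so that `l` belongs to `G(T)ⁿ⁺¹(⊠)(U)`
(`mem_iterate_callGraph`).

The inequality `ψ ≥ ⟦T⟧(ψ)` expresses the continuity of `⟦T⟧`. It rests on the compactness of the
space of values (`Value.exists_limit`), a consequence of the finiteness of the sets of symbols: it is
needed for destructors of records and for the compactness of `0`. Finiteness also makes the
carriers of elements of `𝒜` coincide with the closed sets of values
(`Approx.isClosedUpper_carrier`, `Approx.IsClosedUpper.finGen`), from which the values of each of
the operations on sums are determined.
-/

namespace SizeChange

noncomputable section

/-! ### Values: order and truncations -/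

namespace Value

variable {C D : Type*} {P : Finset ℕ}

/-- The value with root symbol `s` and subtrees `f`. -/
def node (s : Shape C D P) (f : Arity s → Value C D P) : Value C D P :=
  PFunctor.M.mk (F := ValueF C D P) ⟨s, f⟩

/-- The root symbol of a value. -/
def shape (v : Value C D P) : Shape C D P := (PFunctor.M.dest (F := ValueF C D P) v).1

/-- The subtrees directly below the root of a value. -/
def child (v : Value C D P) : Arity v.shape → Value C D P :=
  (PFunctor.M.dest (F := ValueF C D P) v).2

theorem node_shape_child (v : Value C D P) : node v.shape v.child = v :=
  PFunctor.M.mk_dest (F := ValueF C D P) v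

theorem node_inj {s : Shape C D P} {f g : Arity s → Value C D P} (h : node s f = node s g) :
    f = g := by
  have h' : (⟨s, f⟩ : Σ s : Shape C D P, Arity s → Value C D P) = ⟨s, g⟩ :=
    PFunctor.M.mk_inj (F := ValueF C D P) h
  simpa using h'

/-- The tree generated by a coalgebra. -/
def unfold {α : Type*} (s : α → Shape C D P) (k : ∀ a, Arity (s a) → α) : α → Value C D P :=
  PFunctor.M.corec (F := ValueF C D P) fun a => ⟨s a, k a⟩

theorem unfold_eq {α : Type*} (s : α → Shape C D P) (k : ∀ a, Arity (s a) → α) (a : α) :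
    unfold s k a = node (s a) fun i => unfold s k (k a i) :=
  PFunctor.M.corec_def (F := ValueF C D P) (fun a => ⟨s a, k a⟩) a

theorem node_bot (f : Arity (Shape.bot : Shape C D P) → Value C D P) : node .bot f = bot :=
  congrArg (node .bot) (funext fun i => PEmpty.elim i)

theorem exists_eq (v : Value C D P) :
    v = bot ∨ (∃ c p u, v = con c p u) ∨ ∃ p F x, v = record p F x := by
  rw [← node_shape_child v]
  generalize v.child = f
  revert f
  generalize v.shape = s
  intro f
  cases s with
  | bot => exact Or.inl (node_bot f)
  | con c p => exact Or.inr (Or.inl ⟨c, p, f PUnit.unit, rfl⟩)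
  | record p F => exact Or.inr (Or.inr ⟨p, F, f, rfl⟩)

@[simp] theorem shape_bot : (bot : Value C D P).shape = .bot := rfl

@[simp] theorem shape_con (c : C) (p : OddPrio P) (v : Value C D P) :
    (con c p v).shape = .con c p := rfl

@[simp] theorem shape_record (p : EvenPrio P) (F : Finset D)
    (x : {d : D // d ∈ F} → Value C D P) : (record p F x).shape = .record p F := rfl

theorem con_inj {c c' : C} {p p' : OddPrio P} {v v' : Value C D P} :
    con c p v = con c' p' v' ↔ c = c' ∧ p = p' ∧ v = v' := by
  refine ⟨fun h => ?_, by rintro ⟨rfl, rfl, rfl⟩; rfl⟩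
  have hs := congrArg shape h
  simp only [shape_con, Shape.con.injEq] at hs
  obtain ⟨rfl, rfl⟩ := hs
  exact ⟨rfl, rfl, congrFun (node_inj h) PUnit.unit⟩

theorem record_inj {p p' : EvenPrio P} {F : Finset D} {x y : {d : D // d ∈ F} → Value C D P} :
    record p F x = record p' F y ↔ p = p' ∧ x = y := by
  refine ⟨fun h => ?_, by rintro ⟨rfl, rfl⟩; rfl⟩
  have hs := congrArg shape h
  simp only [shape_record, Shape.record.injEq, and_true] at hs
  subst hs
  exact ⟨rfl, node_inj h⟩

theorem shape_eq_of_record_eq {p p' : EvenPrio P} {F F' : Finset D}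
    {x : {d : D // d ∈ F} → Value C D P} {y : {d : D // d ∈ F'} → Value C D P}
    (h : record p F x = record p' F' y) : p = p' ∧ F = F' := by
  simpa using congrArg shape h

theorem con_ne_bot (c : C) (p : OddPrio P) (v : Value C D P) : con c p v ≠ bot :=
  fun h => by simpa using congrArg shape h

theorem record_ne_bot (p : EvenPrio P) (F : Finset D) (x : {d : D // d ∈ F} → Value C D P) :
    record p F x ≠ bot :=
  fun h => by simpa using congrArg shape h

theorem con_ne_record (c : C) (p : OddPrio P) (v : Value C D P) (q : EvenPrio P) (F : Finset D)
    (x : {d : D // d ∈ F} → Value C D P) : con c p v ≠ record q F x :=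
  fun h => by simpa using congrArg shape h

theorem le_cases {u v : Value C D P} (h : u ≤ v) :
    u = bot ∨
    (∃ c p u' v', u = con c p u' ∧ v = con c p v' ∧ u' ≤ v') ∨
    (∃ p F, ∃ x y : {d : D // d ∈ F} → Value C D P,
      u = record p F x ∧ v = record p F y ∧ ∀ d, x d ≤ y d) := by
  obtain ⟨R, hR, huv⟩ := h
  rcases hR u v huv with h | ⟨c, p, u', v', hu, hv, h⟩ | ⟨p, F, x, y, hu, hv, h⟩
  · exact Or.inl h
  · exact Or.inr (Or.inl ⟨c, p, u', v', hu, hv, R, hR, h⟩)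
  · exact Or.inr (Or.inr ⟨p, F, x, y, hu, hv, fun d => ⟨R, hR, h d⟩⟩)

theorem bot_le (v : Value C D P) : bot ≤ v :=
  ⟨fun u _ => u = bot, fun _ _ h => Or.inl h, rfl⟩

theorem con_le_con (c : C) (p : OddPrio P) {u v : Value C D P} (h : u ≤ v) :
    con c p u ≤ con c p v := by
  refine ⟨fun a b => a ≤ b ∨ a = con c p u ∧ b = con c p v, ?_, Or.inr ⟨rfl, rfl⟩⟩
  rintro a b (hab | ⟨rfl, rfl⟩)
  · rcases le_cases hab with h | ⟨c, p, u', v', hu, hv, h⟩ | ⟨p, F, x, y, hu, hv, h⟩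
    · exact Or.inl h
    · exact Or.inr (Or.inl ⟨c, p, u', v', hu, hv, Or.inl h⟩)
    · exact Or.inr (Or.inr ⟨p, F, x, y, hu, hv, fun d => Or.inl (h d)⟩)
  · exact Or.inr (Or.inl ⟨c, p, u, v, rfl, rfl, Or.inl h⟩)

theorem record_le_record (p : EvenPrio P) (F : Finset D) {x y : {d : D // d ∈ F} → Value C D P}
    (h : ∀ d, x d ≤ y d) : record p F x ≤ record p F y := by
  refine ⟨fun a b => a ≤ b ∨ a = record p F x ∧ b = record p F y, ?_, Or.inr ⟨rfl, rfl⟩⟩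
  rintro a b (hab | ⟨rfl, rfl⟩)
  · rcases le_cases hab with h | ⟨c, p, u', v', hu, hv, h⟩ | ⟨p, F, x, y, hu, hv, h⟩
    · exact Or.inl h
    · exact Or.inr (Or.inl ⟨c, p, u', v', hu, hv, Or.inl h⟩)
    · exact Or.inr (Or.inr ⟨p, F, x, y, hu, hv, fun d => Or.inl (h d)⟩)
  · exact Or.inr (Or.inr ⟨p, F, x, y, rfl, rfl, fun d => Or.inl (h d)⟩)

theorem con_le_iff {c : C} {p : OddPrio P} {u w : Value C D P} :
    con c p u ≤ w ↔ ∃ w', w = con c p w' ∧ u ≤ w' := by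
  refine ⟨fun h => ?_, by rintro ⟨w', rfl, h⟩; exact con_le_con c p h⟩
  rcases le_cases h with h | ⟨c', p', u', w', hu, rfl, h⟩ | ⟨p', F, x, y, hu, -, -⟩
  · exact absurd h (con_ne_bot _ _ _)
  · obtain ⟨rfl, rfl, rfl⟩ := con_inj.mp hu
    exact ⟨w', rfl, h⟩
  · exact absurd hu (con_ne_record _ _ _ _ _ _)

theorem record_le_iff {p : EvenPrio P} {F : Finset D} {x : {d : D // d ∈ F} → Value C D P}
    {w : Value C D P} : record p F x ≤ w ↔ ∃ y, w = record p F y ∧ ∀ d, x d ≤ y d := by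
  refine ⟨fun h => ?_, by rintro ⟨w', rfl, h⟩; exact record_le_record p F h⟩
  rcases le_cases h with h | ⟨c', p', u', w', hu, -, -⟩ | ⟨p', F', x', y, hu, rfl, h⟩
  · exact absurd h (record_ne_bot _ _ _)
  · exact absurd hu.symm (con_ne_record _ _ _ _ _ _)
  · obtain ⟨rfl, rfl⟩ := shape_eq_of_record_eq hu
    obtain ⟨-, rfl⟩ := record_inj.mp hu
    exact ⟨y, rfl, h⟩

theorem le_refl (v : Value C D P) : v ≤ v := by
  refine ⟨Eq, ?_, rfl⟩
  rintro u _ rfl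
  rcases exists_eq u with h | ⟨c, p, u', h⟩ | ⟨p, F, x, h⟩
  · exact Or.inl h
  · exact Or.inr (Or.inl ⟨c, p, u', u', h, h, rfl⟩)
  · exact Or.inr (Or.inr ⟨p, F, x, x, h, h, fun _ => rfl⟩)

theorem le_trans {u v w : Value C D P} (huv : u ≤ v) (hvw : v ≤ w) : u ≤ w := by
  refine ⟨fun a c => ∃ b, a ≤ b ∧ b ≤ c, ?_, v, huv, hvw⟩
  rintro a c ⟨b, hab, hbc⟩
  rcases le_cases hab with h | ⟨c, p, u', v', rfl, rfl, h⟩ | ⟨p, F, x, y, rfl, rfl, h⟩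
  · exact Or.inl h
  · obtain ⟨w', rfl, h'⟩ := con_le_iff.mp hbc
    exact Or.inr (Or.inl ⟨c, p, u', w', rfl, rfl, v', h, h'⟩)
  · obtain ⟨z, rfl, h'⟩ := record_le_iff.mp hbc
    exact Or.inr (Or.inr ⟨p, F, x, z, rfl, rfl, fun d => ⟨y d, h d, h' d⟩⟩)

/-- `trunc n v` cuts the tree `v` at depth `n`, putting `⊥` there. -/
def trunc : ℕ → Value C D P → Value C D P
  | 0, _ => bot
  | n + 1, v => node v.shape fun i => trunc n (v.child i)

@[simp] theorem trunc_zero (v : Value C D P) : trunc 0 v = bot := rfl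

@[simp] theorem trunc_bot (n : ℕ) : trunc n (bot : Value C D P) = bot := by
  cases n
  · rfl
  · exact node_bot _

@[simp] theorem trunc_succ_con (n : ℕ) (c : C) (p : OddPrio P) (v : Value C D P) :
    trunc (n + 1) (con c p v) = con c p (trunc n v) := rfl

@[simp] theorem trunc_succ_record (n : ℕ) (p : EvenPrio P) (F : Finset D)
    (x : {d : D // d ∈ F} → Value C D P) :
    trunc (n + 1) (record p F x) = record p F fun d => trunc n (x d) := rfl

theorem trunc_le (n : ℕ) (v : Value C D P) : trunc n v ≤ v := by
  induction n generalizing v with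
  | zero => exact bot_le v
  | succ n ih =>
    rcases exists_eq v with rfl | ⟨c, p, u, rfl⟩ | ⟨p, F, x, rfl⟩
    · simpa using bot_le _
    · exact con_le_con c p (ih u)
    · exact record_le_record p F fun d => ih (x d)

theorem trunc_mono (n : ℕ) {v w : Value C D P} (h : v ≤ w) : trunc n v ≤ trunc n w := by
  induction n generalizing v w with
  | zero => exact bot_le _
  | succ n ih =>
    rcases le_cases h with rfl | ⟨c, p, u', v', rfl, rfl, h'⟩ | ⟨p, F, x, y, rfl, rfl, h'⟩
    · simpa using bot_le _
    · exact con_le_con c p (ih h')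
    · exact record_le_record p F fun d => ih (h' d)

theorem trunc_le_trunc {n m : ℕ} (h : n ≤ m) (v : Value C D P) : trunc n v ≤ trunc m v := by
  induction n generalizing m v with
  | zero => exact bot_le _
  | succ n ih =>
    obtain ⟨m, rfl⟩ := Nat.exists_eq_add_of_le' (Nat.lt_of_lt_of_le n.succ_pos h)
    rcases exists_eq v with rfl | ⟨c, p, u, rfl⟩ | ⟨p, F, x, rfl⟩
    · simpa using bot_le _
    · exact con_le_con c p (ih (by omega) u)
    · exact record_le_record p F fun d => ih (by omega) (x d)

theorem le_of_forall_trunc_le {v w : Value C D P} (h : ∀ n, trunc n v ≤ w) : v ≤ w := by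
  refine ⟨fun v w => ∀ n, trunc n v ≤ w, ?_, h⟩
  intro v w h
  rcases exists_eq v with rfl | ⟨c, p, u, rfl⟩ | ⟨p, F, x, rfl⟩
  · exact Or.inl rfl
  · obtain ⟨w', rfl, -⟩ := con_le_iff.mp (h 1)
    refine Or.inr (Or.inl ⟨c, p, u, w', rfl, rfl, fun n => ?_⟩)
    have hn := h (n + 1)
    rw [trunc_succ_con] at hn
    obtain ⟨w'', hw, hn⟩ := con_le_iff.mp hn
    obtain ⟨-, -, rfl⟩ := con_inj.mp hw
    exact hn
  · obtain ⟨y, rfl, -⟩ := record_le_iff.mp (h 1)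
    refine Or.inr (Or.inr ⟨p, F, x, y, rfl, rfl, fun d n => ?_⟩)
    obtain ⟨y', hy, hn⟩ := record_le_iff.mp (h (n + 1))
    obtain ⟨-, rfl⟩ := record_inj.mp hy
    exact hn d

theorem isFinite_trunc (n : ℕ) (v : Value C D P) : (trunc n v).IsFinite := by
  induction n generalizing v with
  | zero => exact .bot
  | succ n ih =>
    rcases exists_eq v with rfl | ⟨c, p, u, rfl⟩ | ⟨p, F, x, rfl⟩
    · simpa using IsFinite.bot
    · exact .con c p _ (ih u)
    · exact .record p F _ fun d => ih (x d)

theorem IsFinite.eventually_trunc_eq {v : Value C D P} (hv : v.IsFinite) :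
    ∀ᶠ n in Filter.atTop, trunc n v = v := by
  induction hv with
  | bot => simp
  | con c p v _ ih =>
    rw [← Filter.map_add_atTop_eq_nat 1, Filter.eventually_map]
    filter_upwards [ih] with n hn
    rw [trunc_succ_con, hn]
  | record p F x _ ih =>
    rw [← Filter.map_add_atTop_eq_nat 1, Filter.eventually_map]
    filter_upwards [Filter.eventually_all.mpr ih] with n hn
    simp only [trunc_succ_record, hn]

instance : Finite (OddPrio P) :=
  Set.Finite.subset (s := {p | p ∈ P}) P.finite_toSet fun _ h => h.1

instance : Finite (EvenPrio P) :=
  Set.Finite.subset (s := {p | p ∈ P}) P.finite_toSet fun _ h => h.1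

instance [Finite C] [Finite D] : Finite (Shape C D P) := by
  let f : Shape C D P → Option ((C × OddPrio P) ⊕ (EvenPrio P × Finset D))
    | .bot => none
    | .con c p => some (.inl (c, p))
    | .record p F => some (.inr (p, F))
  refine Finite.of_injective f ?_
  rintro (_ | ⟨c, p⟩ | ⟨p, F⟩) (_ | ⟨c', p'⟩ | ⟨p', F'⟩) <;> simp [f]

instance (s : Shape C D P) : Finite (Arity s) := by
  cases s
  · exact inferInstanceAs (Finite PEmpty)
  · exact inferInstanceAs (Finite PUnit)
  · exact inferInstanceAs (Finite {d : D // d ∈ _})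

theorem finite_range_trunc [Finite C] [Finite D] (n : ℕ) :
    (Set.range (trunc n : Value C D P → Value C D P)).Finite := by
  induction n with
  | zero => exact (Set.finite_singleton bot).subset (by rintro _ ⟨v, rfl⟩; rfl)
  | succ n ih =>
    have : Finite (Set.range (trunc n : Value C D P → Value C D P)) := ih
    let f : (Σ s : Shape C D P, Arity s → Set.range (trunc n : Value C D P → Value C D P)) →
        Value C D P := fun a => node a.1 fun i => (a.2 i).1
    refine (Set.finite_range f).subset ?_
    rintro _ ⟨v, rfl⟩
    exact ⟨⟨v.shape, fun i => ⟨trunc n (v.child i), v.child i, rfl⟩⟩, rfl⟩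

/-! ### Compactness of the space of values -/

section Limit

variable [Finite C] [Finite D]

open Filter

theorem exists_eventually_shape_eq (w : ℕ → Value C D P) :
    ∃ s, ∀ᶠ m in (hyperfilter ℕ : Filter ℕ), (w m).shape = s := by
  have h : ∀ᶠ m in (hyperfilter ℕ : Filter ℕ), ∃ s ∈ (Set.univ : Set (Shape C D P)),
      (w m).shape = s := Eventually.of_forall fun m => ⟨_, trivial, rfl⟩
  obtain ⟨s, -, hs⟩ := (Ultrafilter.eventually_exists_mem_iff Set.finite_univ).mp h
  exact ⟨s, hs⟩

open Classical in
/-- The sequence of the subtrees at position `i`, for a sequence of values with root symbol `s`; the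
terms with another root symbol are replaced by `⊥`. -/
def childSeq (w : ℕ → Value C D P) (s : Shape C D P) (i : Arity s) (m : ℕ) : Value C D P :=
  if h : (w m).shape = s then (w m).child (h ▸ i) else bot

/-- The limit of a sequence of values along a fixed nonprincipal ultrafilter on `ℕ`. As there are
finitely many root symbols, almost all terms of the sequence share the same one, and the
construction goes on below it. -/
def ultraLim : (ℕ → Value C D P) → Value C D P :=
  unfold (fun w => (exists_eventually_shape_eq w).choose)
    fun w => childSeq w (exists_eventually_shape_eq w).choose

/-- Up to any fixed depth, the limit agrees with almost all terms of the sequence. -/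
theorem eventually_trunc_ultraLim (w : ℕ → Value C D P) (n : ℕ) :
    ∀ᶠ m in (hyperfilter ℕ : Filter ℕ), trunc n (ultraLim w) = trunc n (w m) := by
  induction n generalizing w with
  | zero => simp
  | succ n ih =>
    set s := (exists_eventually_shape_eq w).choose
    have hw : ultraLim w = node s fun i => ultraLim (childSeq w s i) := unfold_eq _ _ w
    have h₁ : ∀ᶠ m in (hyperfilter ℕ : Filter ℕ), (w m).shape = s :=
      (exists_eventually_shape_eq w).choose_spec
    filter_upwards [h₁, eventually_all.mpr fun i => ih (childSeq w s i)] with m hm hi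
    have hwm : w m = node s fun i => childSeq w s i m := by
      rw [← node_shape_child (w m)]
      clear_value s
      subst hm
      congr 1
      funext i
      simp [childSeq]
    rw [hwm, hw]
    exact congrArg (node s) (funext hi)

/-- Sequential compactness of the space of values. -/
theorem exists_limit (w : ℕ → Value C D P) :
    ∃ v : Value C D P, ∀ n N, ∃ m, N ≤ m ∧ trunc n v = trunc n (w m) := by
  refine ⟨ultraLim w, fun n N => ?_⟩
  have h : ∀ᶠ m in (hyperfilter ℕ : Filter ℕ), N ≤ m :=
    Nat.hyperfilter_le_atTop (eventually_ge_atTop N)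
  obtain ⟨m, hm, hN⟩ := ((eventually_trunc_ultraLim w n).and h).exists
  exact ⟨m, hN, hm⟩

end Limit

end Value

/-! ### Closed sets of values and the operations on sums -/

namespace Approx

open Value

variable {C D : Type*} {P : Finset ℕ}

/-- A set of values is closed (and upward closed) when it contains every value that is, for each
`n`, above the truncation at depth `n` of some element of the set. As there are finitely many symbols, these are exactly the carriers of the
elements of `𝒜`. -/
def IsClosedUpper (X : Set (Value C D P)) : Prop :=
  ∀ v, (∀ n, ∃ x ∈ X, trunc n x ≤ v) → v ∈ X

theorem isClosedUpper_carrier (U : Approx C D P) : IsClosedUpper U.carrier := by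
  obtain ⟨𝒦, h𝒦, hU⟩ := U.finGen
  intro v hv
  rw [hU] at hv ⊢
  refine Set.mem_iInter₂.mpr fun K hK => ?_
  obtain ⟨n, hn⟩ := ((Filter.eventually_all_finite (h𝒦 K hK).1).mpr
    fun k hk => ((h𝒦 K hK).2 k hk).eventually_trunc_eq).exists
  obtain ⟨x, hx, hxv⟩ := hv n
  obtain ⟨k, hk, hkx⟩ := Set.mem_iInter₂.mp hx K hK
  refine ⟨k, hk, ?_⟩
  rw [← hn k hk]
  exact Value.le_trans (trunc_mono n hkx) hxv

theorem mem_of_le {U : Approx C D P} {v w : Value C D P} (hv : v ∈ U.carrier) (h : v ≤ w) :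
    w ∈ U.carrier :=
  U.isClosedUpper_carrier w fun n => ⟨v, hv, Value.le_trans (trunc_le n v) h⟩

theorem eq_top_iff_carrier {U : Approx C D P} : U = ⊤ ↔ U.carrier = ∅ :=
  ⟨fun h => h ▸ carrier_top, fun h => ext_carrier (h.trans carrier_top.symm)⟩

theorem ne_top_of_mem {U : Approx C D P} {v : Value C D P} (h : v ∈ U.carrier) : U ≠ ⊤ := by
  rintro rfl
  rw [carrier_top] at h
  exact h

theorem exists_mem_of_ne_top {U : Approx C D P} (h : U ≠ ⊤) : ∃ v, v ∈ U.carrier :=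
  Set.nonempty_iff_ne_empty.mpr fun h' => h (eq_top_iff_carrier.mpr h')

theorem mem_iSup {ι : Sort*} {W : ι → Approx C D P} {v : Value C D P} :
    v ∈ (⨆ i, W i).carrier ↔ ∀ i, v ∈ (W i).carrier := by
  show v ∈ ⋂ U ∈ Set.range W, U.carrier ↔ _
  simp

theorem subset_carrier_sum (X : Set (Value C D P)) : X ⊆ (sum X).carrier :=
  Set.subset_iInter₂ fun _ h => h

section

variable [Finite C] [Finite D]

theorem IsClosedUpper.finGen {X : Set (Value C D P)} (hX : IsClosedUpper X) :
    ∃ 𝒦 : Set (Set (Value C D P)),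
      (∀ K ∈ 𝒦, K.Finite ∧ ∀ k ∈ K, k.IsFinite) ∧ X = ⋂ K ∈ 𝒦, up K := by
  refine ⟨Set.range fun n => trunc n '' X, ?_, ?_⟩
  · rintro _ ⟨n, rfl⟩
    refine ⟨(finite_range_trunc n).subset (Set.image_subset_range _ _), ?_⟩
    rintro _ ⟨v, -, rfl⟩
    exact isFinite_trunc n v
  · ext v
    simp only [Set.mem_iInter, Set.forall_mem_range, up, Set.mem_ofPred_eq, Set.exists_mem_image]
    exact ⟨fun hv n => ⟨v, hv, trunc_le n v⟩, hX v⟩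

theorem carrier_sum {X : Set (Value C D P)} (hX : IsClosedUpper X) : (sum X).carrier = X :=
  (Set.biInter_subset_of_mem (t := fun U : Approx C D P => U.carrier)
    (show (⟨X, hX.finGen⟩ : Approx C D P) ∈ {U : Approx C D P | X ⊆ U.carrier} from
      Set.Subset.rfl)).antisymm (subset_carrier_sum X)

theorem carrier_inf (U V : Approx C D P) : (U ⊓ V).carrier = U.carrier ∪ V.carrier := by
  have hX : IsClosedUpper (U.carrier ∪ V.carrier) := by
    intro v hv
    by_contra h
    rw [Set.mem_union, not_or] at h
    have h₁ := mt (U.isClosedUpper_carrier v) h.1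
    have h₂ := mt (V.isClosedUpper_carrier v) h.2
    push Not at h₁ h₂
    obtain ⟨n, hn⟩ := h₁
    obtain ⟨m, hm⟩ := h₂
    obtain ⟨x, hx | hx, hxv⟩ := hv (max n m)
    · exact hn x hx (Value.le_trans (trunc_le_trunc (le_max_left n m) x) hxv)
    · exact hm x hx (Value.le_trans (trunc_le_trunc (le_max_right n m) x) hxv)
  have h₁ : (⟨_, hX.finGen⟩ : Approx C D P) ≤ U ⊓ V :=
    le_inf Set.subset_union_left Set.subset_union_right
  exact Set.Subset.antisymm h₁
    (Set.union_subset (inf_le_left : U ⊓ V ≤ U) (inf_le_right : U ⊓ V ≤ V))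

theorem mem_iInf_list {α : Type*} {T : List α} {W : α → Approx C D P} {v : Value C D P} :
    v ∈ (⨅ t ∈ T, W t).carrier ↔ ∃ t ∈ T, v ∈ (W t).carrier := by
  induction T with
  | nil => simp [carrier_top]
  | cons a T ih =>
    have : (⨅ t ∈ a :: T, W t) = W a ⊓ ⨅ t ∈ T, W t := by
      simp [iInf_or, iInf_inf_eq]
    rw [this, carrier_inf, Set.mem_union, ih]
    simp

theorem mem_con {c : C} {p : OddPrio P} {U : Approx C D P} {v : Value C D P} :
    v ∈ (con c p U).carrier ↔ ∃ u ∈ U.carrier, v = .con c p u := by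
  rw [con, carrier_sum]
  · rfl
  intro v hv
  obtain ⟨_, ⟨u, -, rfl⟩, hu⟩ := hv 1
  obtain ⟨v, rfl, -⟩ := con_le_iff.mp hu
  refine ⟨v, U.isClosedUpper_carrier v fun n => ?_, rfl⟩
  obtain ⟨_, ⟨u, hu, rfl⟩, hn⟩ := hv (n + 1)
  rw [trunc_succ_con] at hn
  obtain ⟨v', h, hn⟩ := con_le_iff.mp hn
  obtain ⟨-, -, rfl⟩ := con_inj.mp h
  exact ⟨u, hu, hn⟩

theorem mem_record {p : EvenPrio P} {F : Finset D} {U : {d : D // d ∈ F} → Approx C D P}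
    {v : Value C D P} :
    v ∈ (record p F U).carrier ↔ ∃ x : {d : D // d ∈ F} → Value C D P,
      (∀ d, x d ∈ (U d).carrier) ∧ v = .record p F x := by
  rw [record, carrier_sum]
  · rfl
  intro v hv
  obtain ⟨_, ⟨x, -, rfl⟩, hx⟩ := hv 1
  obtain ⟨v, rfl, -⟩ := record_le_iff.mp hx
  refine ⟨v, fun d => (U d).isClosedUpper_carrier (v d) fun n => ?_, rfl⟩
  obtain ⟨_, ⟨x, hx, rfl⟩, hn⟩ := hv (n + 1)
  rw [trunc_succ_record] at hn
  obtain ⟨v', h, hn⟩ := record_le_iff.mp hn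
  obtain ⟨-, rfl⟩ := record_inj.mp h
  exact ⟨x d, hx d, hn d⟩

theorem mem_uncon {c : C} {p : OddPrio P} {U : Approx C D P} {u : Value C D P} :
    u ∈ (uncon c p U).carrier ↔ .con c p u ∈ U.carrier := by
  have h : {u | Value.bot ∈ U.carrier ∨ Value.con c p u ∈ U.carrier} =
      {u | Value.con c p u ∈ U.carrier} :=
    Set.ext fun u => or_iff_right_of_imp fun h => mem_of_le h (Value.bot_le _)
  rw [uncon, h, carrier_sum]
  · rfl
  intro v hv
  refine U.isClosedUpper_carrier _ fun n => ?_
  obtain ⟨u, hu, hn⟩ := hv n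
  exact ⟨_, hu, Value.le_trans (trunc_le_trunc n.le_succ _) (con_le_con c p hn)⟩

/-- In a decreasing sequence of carriers, if the `n`th one contains a record whose field `d` is, up
to depth `n`, below `v`, then some record whose field `d` is `v` belongs to all of them. The other
fields of the given records may vary with `n`, so that compactness is needed here. -/
theorem exists_record_of_forall {W : ℕ → Approx C D P} (hW : Monotone W) {p : EvenPrio P} {d : D}
    {v : Value C D P}
    (h : ∀ n, ∃ (F : Finset D) (x : {d : D // d ∈ F} → Value C D P) (hd : d ∈ F),
      Value.record p F x ∈ (W n).carrier ∧ trunc n (x ⟨d, hd⟩) ≤ v) :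
    ∃ (F : Finset D) (x : {d : D // d ∈ F} → Value C D P) (hd : d ∈ F),
      (∀ n, Value.record p F x ∈ (W n).carrier) ∧ v = x ⟨d, hd⟩ := by
  classical
  choose F x hd hx hv using h
  obtain ⟨w, hw⟩ := exists_limit fun n => Value.record p (F n) (x n)
  have hmem : ∀ n, w ∈ (W n).carrier := by
    refine fun n => (W n).isClosedUpper_carrier w fun k => ?_
    obtain ⟨m, hnm, hm⟩ := hw k n
    exact ⟨_, hW hnm (hx m), hm ▸ trunc_le k w⟩
  obtain ⟨N, -, hN⟩ := hw 1 0
  obtain ⟨y, rfl, -⟩ : ∃ y, w = Value.record p (F N) y ∧ _ :=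
    (record_le_iff (x := fun i => trunc 0 (x N i))).mp (by
      rw [← trunc_succ_record, ← hN]
      exact trunc_le 1 w)
  have hy : y ⟨d, hd N⟩ ≤ v := by
    refine le_of_forall_trunc_le fun n => ?_
    obtain ⟨m, hnm, hm⟩ := hw (n + 1) n
    simp only [trunc_succ_record] at hm
    have hF := (shape_eq_of_record_eq hm).2
    have key : ∀ (G : Finset D) (z : {d : D // d ∈ G} → Value C D P) (hG : d ∈ G),
        (Value.record p (F N) fun i => trunc n (y i)) = .record p G (fun i => trunc n (z i)) →
        trunc n (y ⟨d, hd N⟩) = trunc n (z ⟨d, hG⟩) := by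
      intro G z hG h
      obtain ⟨-, rfl⟩ := shape_eq_of_record_eq h
      exact congrFun (record_inj.mp h).2 ⟨d, _⟩
    rw [key _ _ (hd m) hm]
    exact Value.le_trans (trunc_le_trunc hnm _) (hv m)
  refine ⟨F N, Function.update y ⟨d, hd N⟩ v, hd N, fun n => mem_of_le (hmem n) ?_, by simp⟩
  refine record_le_record _ _ fun i => ?_
  by_cases hi : i = ⟨d, hd N⟩
  · subst hi
    simpa using hy
  · simpa [hi] using Value.le_refl _

theorem mem_proj {d : D} {p : EvenPrio P} {U : Approx C D P} {u : Value C D P} :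
    u ∈ (proj d p U).carrier ↔ ∃ (F : Finset D) (x : {d : D // d ∈ F} → Value C D P) (h : d ∈ F),
      .record p F x ∈ U.carrier ∧ u = x ⟨d, h⟩ := by
  set X := {u : Value C D P | ∃ (F : Finset D) (x : {d : D // d ∈ F} → Value C D P) (h : d ∈ F),
      .record p F x ∈ U.carrier ∧ u = x ⟨d, h⟩} with hX
  have h : {u | Value.bot ∈ U.carrier ∨ u ∈ X} = X :=
    Set.ext fun u => or_iff_right_of_imp fun h =>
      ⟨{d}, fun _ => u, Finset.mem_singleton_self d, mem_of_le h (Value.bot_le _), rfl⟩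
  show u ∈ (sum {u | Value.bot ∈ U.carrier ∨ u ∈ X}).carrier ↔ u ∈ X
  rw [h, carrier_sum]
  intro v hv
  obtain ⟨F, x, hd, hx, rfl⟩ := exists_record_of_forall (W := fun _ => U) monotone_const
    (p := p) (d := d) (v := v) fun n => by
      obtain ⟨_, ⟨F, x, hd, hx, rfl⟩, hn⟩ := hv n
      exact ⟨F, x, hd, hx, hn⟩
  exact ⟨F, x, hd, hx 0, rfl⟩

/-! ### Monotonicity and continuity of the operations -/

theorem con_mono (c : C) (p : OddPrio P) : Monotone (con (D := D) c p) := by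
  intro U V h v hv
  obtain ⟨u, hu, rfl⟩ := mem_con.mp hv
  exact mem_con.mpr ⟨u, h hu, rfl⟩

theorem record_mono (p : EvenPrio P) (F : Finset D) : Monotone (record (C := C) p F) := by
  intro U V h v hv
  obtain ⟨x, hx, rfl⟩ := mem_record.mp hv
  exact mem_record.mpr ⟨x, fun d => h d (hx d), rfl⟩

theorem uncon_mono (c : C) (p : OddPrio P) : Monotone (uncon (D := D) c p) :=
  fun _ _ h _ hv => mem_uncon.mpr (h (mem_uncon.mp hv))

theorem proj_mono (d : D) (p : EvenPrio P) : Monotone (proj (C := C) d p) := by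
  intro U V h v hv
  obtain ⟨F, x, hd, hx, rfl⟩ := mem_proj.mp hv
  exact mem_proj.mpr ⟨F, x, hd, h hx, rfl⟩

theorem con_iSup_le (c : C) (p : OddPrio P) (W : ℕ → Approx C D P) :
    con c p (⨆ n, W n) ≤ ⨆ n, con c p (W n) := by
  intro v hv
  obtain ⟨u, -, rfl⟩ := mem_con.mp (mem_iSup.mp hv 0)
  refine mem_con.mpr ⟨u, mem_iSup.mpr fun n => ?_, rfl⟩
  obtain ⟨u', hu', h⟩ := mem_con.mp (mem_iSup.mp hv n)
  obtain ⟨-, -, rfl⟩ := con_inj.mp h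
  exact hu'

theorem record_iSup_le (p : EvenPrio P) (F : Finset D)
    (W : ℕ → {d : D // d ∈ F} → Approx C D P) :
    (record p F fun d => ⨆ n, W n d) ≤ ⨆ n, record p F (W n) := by
  intro v hv
  obtain ⟨x, -, rfl⟩ := mem_record.mp (mem_iSup.mp hv 0)
  refine mem_record.mpr ⟨x, fun d => mem_iSup.mpr fun n => ?_, rfl⟩
  obtain ⟨x', hx', h⟩ := mem_record.mp (mem_iSup.mp hv n)
  obtain ⟨-, rfl⟩ := record_inj.mp h
  exact hx' d

theorem uncon_iSup_le (c : C) (p : OddPrio P) (W : ℕ → Approx C D P) :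
    uncon c p (⨆ n, W n) ≤ ⨆ n, uncon c p (W n) :=
  fun _ hv => mem_uncon.mpr (mem_iSup.mpr fun n => mem_uncon.mp (mem_iSup.mp hv n))

theorem proj_iSup_le (d : D) (p : EvenPrio P) {W : ℕ → Approx C D P} (hW : Monotone W) :
    proj d p (⨆ n, W n) ≤ ⨆ n, proj d p (W n) := by
  intro v hv
  obtain ⟨F, x, hd, hx, rfl⟩ := exists_record_of_forall hW (p := p) (d := d) (v := v) fun n => by
    obtain ⟨F, x, hd, hx, rfl⟩ := mem_proj.mp (mem_iSup.mp hv n)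
    exact ⟨F, x, hd, hx, trunc_le n _⟩
  exact mem_proj.mpr ⟨F, x, hd, mem_iSup.mpr hx, rfl⟩

/-- `0` is compact. -/
theorem exists_eq_top_of_iSup_eq_top {W : ℕ → Approx C D P} (hW : Monotone W)
    (h : ⨆ n, W n = ⊤) : ∃ n, W n = ⊤ := by
  by_contra! hne
  choose w hw using fun n => exists_mem_of_ne_top (hne n)
  obtain ⟨v, hv⟩ := exists_limit w
  refine ne_top_of_mem (v := v) (mem_iSup.mpr fun n => ?_) h
  refine (W n).isClosedUpper_carrier v fun k => ?_
  obtain ⟨m, hnm, hm⟩ := hv k n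
  exact ⟨w m, hW hnm (hw m), hm ▸ trunc_le k v⟩

theorem iInf_iSup_le {α : Type*} (T : List α) {W : α → ℕ → Approx C D P}
    (hW : ∀ t ∈ T, Monotone (W t)) : ⨅ t ∈ T, ⨆ n, W t n ≤ ⨆ n, ⨅ t ∈ T, W t n := by
  intro v hv
  by_contra h
  have h' : ∀ t ∈ {t | t ∈ T}, ∀ᶠ n in Filter.atTop, v ∉ (W t n).carrier := by
    intro t ht
    have : v ∉ (⨆ n, W t n).carrier := fun hmem => h (mem_iInf_list.mpr ⟨t, ht, hmem⟩)
    simp only [mem_iSup, not_forall] at this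
    obtain ⟨N, hN⟩ := this
    exact Filter.eventually_atTop.mpr ⟨N, fun n hn hmem => hN (hW t ht hn hmem)⟩
  obtain ⟨n, hn⟩ := ((Filter.eventually_all_finite T.finite_toSet).mpr h').exists
  obtain ⟨t, ht, hmem⟩ := mem_iInf_list.mp (mem_iSup.mp hv n)
  exact hn t ht hmem

end

theorem daimon_top : daimon (⊤ : Approx C D P) = ⊤ := if_pos rfl

theorem daimon_mono : Monotone (daimon : Approx C D P → Approx C D P) := by
  intro U V h
  by_cases hV : V = ⊤
  · simp [daimon, hV]
  · have hU : U ≠ ⊤ := fun hU => hV (top_le_iff.mp (hU ▸ h))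
    simp [daimon, hU]

theorem daimon_le {φ : Approx C D P → Approx C D P} (h : φ ⊤ = ⊤) (U : Approx C D P) :
    daimon U ≤ φ U := by
  by_cases hU : U = ⊤
  · simp [hU, h]
  · simp [daimon, hU]

end Approx

variable {C D N : Type*} {P : Finset ℕ}

/-! ### Semantics of terms -/

/-- Monotone functions preserving the least upper bounds of increasing sequences. -/
structure SeqContinuous (φ : Approx C D P → Approx C D P) : Prop where
  mono : Monotone φ
  map_iSup_le {W : ℕ → Approx C D P} (hW : Monotone W) : φ (⨆ n, W n) ≤ ⨆ n, φ (W n)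

theorem _root_.ScottContinuous.seqContinuous {φ : Approx C D P → Approx C D P}
    (h : ScottContinuous φ) : SeqContinuous φ where
  mono := h.monotone
  map_iSup_le {W} hW := by
    refine (h (Set.range_nonempty W) hW.directed_le.directedOn_range isLUB_iSup).2 ?_
    rintro _ ⟨_, ⟨n, rfl⟩, rfl⟩
    exact le_iSup (fun n => φ (W n)) n

section

variable [Finite C] [Finite D]

open Approx

theorem seqContinuous_daimon : SeqContinuous (daimon : Approx C D P → Approx C D P) where
  mono := daimon_mono
  map_iSup_le {W} hW := by
    by_cases h : ⨆ n, W n = ⊤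
    · obtain ⟨n, hn⟩ := exists_eq_top_of_iSup_eq_top hW h
      exact le_iSup_of_le n (by simp [hn, daimon_top])
    · simp [daimon, h]

namespace Term

theorem sem_top {ρ : N → Approx C D P → Approx C D P} (hρ : ∀ g, ρ g ⊤ = ⊤)
    {φ : Approx C D P → Approx C D P} (hφ : φ ⊤ = ⊤) (t : Term C D N P) :
    t.sem ρ φ ⊤ = ⊤ := by
  induction t with
  | con c p t ih =>
    refine eq_top_iff_carrier.mpr (Set.eq_empty_of_forall_notMem fun v hv => ?_)
    obtain ⟨u, hu, -⟩ := mem_con.mp hv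
    exact ne_top_of_mem hu ih
  | record p F t ih => exact if_pos rfl
  | uncon c p t ih =>
    refine eq_top_iff_carrier.mpr (Set.eq_empty_of_forall_notMem fun v hv => ?_)
    exact ne_top_of_mem (mem_uncon.mp hv) ih
  | proj d p t ih =>
    refine eq_top_iff_carrier.mpr (Set.eq_empty_of_forall_notMem fun v hv => ?_)
    obtain ⟨F, x, hd, hx, -⟩ := mem_proj.mp hv
    exact ne_top_of_mem hx ih
  | x => rfl
  | daimon n θ ih => exact if_pos (Or.inl rfl)
  | call g t ih => simp only [sem, ih, hρ]
  | self t ih => simp only [sem, ih, hφ]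
  | zero => rfl

theorem sem_mono {ρ : N → Approx C D P → Approx C D P} (hρ : ∀ g, Monotone (ρ g))
    {φ ψ : Approx C D P → Approx C D P} (hφ : Monotone φ) (hφψ : φ ≤ ψ) (t : Term C D N P)
    {U V : Approx C D P} (h : U ≤ V) : t.sem ρ φ U ≤ t.sem ρ ψ V := by
  have htop : U = ⊤ → V = ⊤ := fun hU => top_le_iff.mp (hU ▸ h)
  induction t with
  | con c p t ih => exact con_mono c p ih
  | record p F t ih =>
    by_cases hV : V = ⊤
    · simp [sem, hV]
    · have hU := mt htop hV
      simp only [sem, hV, hU, if_false]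
      exact record_mono p F ih
  | uncon c p t ih => exact uncon_mono c p ih
  | proj d p t ih => exact proj_mono d p ih
  | x => exact h
  | daimon n θ ih =>
    simp only [sem]
    split_ifs with h₁ h₂
    · exact le_rfl
    · refine absurd (h₁.imp htop ?_) h₂
      rintro ⟨i, hi⟩
      exact ⟨i, top_le_iff.mp (hi ▸ ih i)⟩
    · exact le_top
    · exact le_rfl
  | call g t ih => exact hρ g ih
  | self t ih => exact (hφ ih).trans (hφψ _)
  | zero => exact le_rfl

/-- `⟦t⟧(φ)(U)` is jointly continuous in `φ` and `U`. -/
theorem sem_iSup_le {ρ : N → Approx C D P → Approx C D P} (hρ : ∀ g, SeqContinuous (ρ g))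
    {φ : ℕ → Approx C D P → Approx C D P} (hφ : Monotone φ) (hφ' : ∀ n, SeqContinuous (φ n))
    {t : Term C D N P} (ht : t.DaimonFree) {W : ℕ → Approx C D P} (hW : Monotone W) :
    t.sem ρ (⨆ n, φ n) (⨆ n, W n) ≤ ⨆ n, t.sem ρ (φ n) (W n) := by
  have hmono : ∀ t : Term C D N P, Monotone fun n => t.sem ρ (φ n) (W n) := fun t n m h =>
    sem_mono (fun g => (hρ g).mono) (hφ' n).mono (hφ h) t (hW h)
  induction t with
  | con c p t ih => exact (con_mono c p (ih ht)).trans (con_iSup_le c p _)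
  | record p F t ih =>
    by_cases h : ⨆ n, W n = ⊤
    · obtain ⟨n, hn⟩ := exists_eq_top_of_iSup_eq_top hW h
      exact le_iSup_of_le n (by simp [sem, hn])
    · have hn : ∀ n, W n ≠ ⊤ := fun n hn => h (top_le_iff.mp (hn ▸ le_iSup W n))
      simp only [sem, h, hn, if_false]
      exact (record_mono p F fun d => ih d (ht d)).trans (record_iSup_le p F _)
  | uncon c p t ih => exact (uncon_mono c p (ih ht)).trans (uncon_iSup_le c p _)
  | proj d p t ih => exact (proj_mono d p (ih ht)).trans (proj_iSup_le d p (hmono t))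
  | x => exact le_rfl
  | daimon n θ ih => exact ht.elim
  | call g t ih => exact ((hρ g).mono (ih ht)).trans ((hρ g).map_iSup_le (hmono t))
  | self t ih =>
    simp only [sem, iSup_apply]
    refine iSup_le fun m => (((hφ' m).mono (ih ht)).trans ((hφ' m).map_iSup_le (hmono t))).trans ?_
    refine iSup_le fun n => le_iSup_of_le (max m n) ?_
    exact (hφ (le_max_left m n) _).trans ((hφ' _).mono (hmono t (le_max_right m n)))
  | zero => exact le_iSup_of_le 0 le_rfl

/-- `⊠` is the least function preserving `0`, so that boxing decreases the semantics. -/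
theorem sem_box_le {ρ : N → Approx C D P → Approx C D P} (hρ : ∀ g, ρ g ⊤ = ⊤)
    {ψ : Approx C D P → Approx C D P} (hψ : ψ ⊤ = ⊤) (φ : Approx C D P → Approx C D P)
    (t : Term C D N P) (U : Approx C D P) : t.box.sem ρ φ U ≤ t.sem ρ ψ U := by
  have key : ∀ (χ : Approx C D P → Approx C D P) (t : Term C D N P), χ ⊤ = ⊤ →
      t.box.sem ρ φ U ≤ t.sem ρ ψ U →
      (Term.daimon 1 fun _ => t.box).sem ρ φ U ≤ χ (t.sem ρ ψ U) := by
    intro χ t hχ ih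
    simp only [sem]
    split_ifs with h
    · rcases h with rfl | ⟨-, h⟩
      · rw [sem_top hρ hψ, hχ]
      · rw [h, top_le_iff] at ih
        rw [ih, hχ]
    · exact bot_le
  induction t with
  | con c p t ih => exact con_mono c p ih
  | record p F t ih =>
    simp only [box, sem]
    split_ifs
    · exact le_rfl
    · exact record_mono p F ih
  | uncon c p t ih => exact uncon_mono c p ih
  | proj d p t ih => exact proj_mono d p ih
  | x => exact le_rfl
  | daimon n θ ih =>
    simp only [box, sem]
    split_ifs with h₁ h₂
    · exact le_rfl
    · refine absurd (h₁.imp id ?_) h₂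
      rintro ⟨i, hi⟩
      exact ⟨i, top_le_iff.mp (hi ▸ ih i)⟩
    · exact le_top
    · exact le_rfl
  | call g t ih => exact key (ρ g) t (hρ g) ih
  | self t ih => exact key ψ t hψ ih
  | zero => exact le_rfl

end Term

/-! ### The least fixed point of the operator of a sum of terms -/

theorem semSum_top {ρ : N → Approx C D P → Approx C D P} (hρ : ∀ g, ρ g ⊤ = ⊤)
    {φ : Approx C D P → Approx C D P} (hφ : φ ⊤ = ⊤) (T : List (Term C D N P)) :
    semSum ρ T φ ⊤ = ⊤ := by
  simp [semSum, Term.sem_top hρ hφ]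

theorem semSum_mono {ρ : N → Approx C D P → Approx C D P} (hρ : ∀ g, Monotone (ρ g))
    {φ ψ : Approx C D P → Approx C D P} (hφ : Monotone φ) (hφψ : φ ≤ ψ)
    (T : List (Term C D N P)) {U V : Approx C D P} (h : U ≤ V) :
    semSum ρ T φ U ≤ semSum ρ T ψ V :=
  iInf₂_mono fun t _ => t.sem_mono hρ hφ hφψ h

theorem semSum_iSup_le {ρ : N → Approx C D P → Approx C D P} (hρ : ∀ g, SeqContinuous (ρ g))
    {φ : ℕ → Approx C D P → Approx C D P} (hφ : Monotone φ) (hφ' : ∀ n, SeqContinuous (φ n))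
    {T : List (Term C D N P)} (hT : ∀ t ∈ T, t.DaimonFree) {W : ℕ → Approx C D P}
    (hW : Monotone W) :
    semSum ρ T (⨆ n, φ n) (⨆ n, W n) ≤ ⨆ n, semSum ρ T (φ n) (W n) :=
  (iInf₂_mono fun t ht => t.sem_iSup_le hρ hφ hφ' (hT t ht) hW).trans
    (iInf_iSup_le T fun t _ n _ h =>
      t.sem_mono (fun g => (hρ g).mono) (hφ' n).mono (hφ h) (hW h))

theorem monotone_iterate_semSum {ρ : N → Approx C D P → Approx C D P}
    (hρ : ∀ g, Monotone (ρ g)) (T : List (Term C D N P)) (n : ℕ) :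
    Monotone ((semSum ρ T)^[n] daimon) := by
  induction n with
  | zero => exact daimon_mono
  | succ n ih =>
    rw [Function.iterate_succ_apply']
    exact fun U V h => semSum_mono hρ ih le_rfl T h

theorem iterate_semSum_top {ρ : N → Approx C D P → Approx C D P} (hρ : ∀ g, ρ g ⊤ = ⊤)
    (T : List (Term C D N P)) (n : ℕ) : (semSum ρ T)^[n] daimon ⊤ = ⊤ := by
  induction n with
  | zero => exact daimon_top
  | succ n ih =>
    rw [Function.iterate_succ_apply']
    exact semSum_top hρ ih T

theorem seqContinuous_iterate_semSum {ρ : N → Approx C D P → Approx C D P}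
    (hρ : ∀ g, SeqContinuous (ρ g)) {T : List (Term C D N P)} (hT : ∀ t ∈ T, t.DaimonFree)
    (n : ℕ) : SeqContinuous ((semSum ρ T)^[n] daimon) := by
  refine ⟨monotone_iterate_semSum (fun g => (hρ g).mono) T n, ?_⟩
  induction n with
  | zero => exact seqContinuous_daimon.map_iSup_le
  | succ n ih =>
    intro W hW
    rw [Function.iterate_succ_apply']
    have h := semSum_iSup_le (φ := fun _ => (semSum ρ T)^[n] daimon) hρ monotone_const
      (fun _ => ⟨monotone_iterate_semSum (fun g => (hρ g).mono) T n, ih⟩) hT hW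
    rwa [iSup_const] at h

theorem iterate_semSum_mono {ρ : N → Approx C D P → Approx C D P} (hρ : ∀ g, Monotone (ρ g))
    (hρ' : ∀ g, ρ g ⊤ = ⊤) (T : List (Term C D N P)) :
    Monotone fun n => (semSum ρ T)^[n] daimon := by
  refine monotone_nat_of_le_succ fun n => ?_
  induction n with
  | zero => exact fun U => daimon_le (semSum_top hρ' daimon_top T) U
  | succ n ih =>
    simp only [Function.iterate_succ_apply'] at ih ⊢
    exact fun U => semSum_mono hρ (monotone_iterate_semSum hρ T n) ih T le_rfl

theorem fix_semSum_top {ρ : N → Approx C D P → Approx C D P} (hρ : ∀ g, ρ g ⊤ = ⊤)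
    (T : List (Term C D N P)) : fix (semSum ρ T) ⊤ = ⊤ := by
  simp [fix, iSup_apply, iterate_semSum_top hρ]

/-- The half of the fixed point equation that allows to unfold a value of `fix(T)`. -/
theorem semSum_fix_le {ρ : N → Approx C D P → Approx C D P} (hρ : ∀ g, SeqContinuous (ρ g))
    (hρ' : ∀ g, ρ g ⊤ = ⊤) {T : List (Term C D N P)} (hT : ∀ t ∈ T, t.DaimonFree)
    (U : Approx C D P) : semSum ρ T (fix (semSum ρ T)) U ≤ fix (semSum ρ T) U := by
  have h := semSum_iSup_le hρ (iterate_semSum_mono (fun g => (hρ g).mono) hρ' T)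
    (seqContinuous_iterate_semSum hρ hT) hT (W := fun _ => U) monotone_const
  rw [iSup_const] at h
  refine h.trans (iSup_le fun n => ?_)
  rw [← Function.iterate_succ_apply' (semSum ρ T)]
  exact le_iSup (fun n => (semSum ρ T)^[n] daimon) (n + 1) U

end

/-! ### Bad branches of values -/

namespace Value

theorem Step.of_con {c : C} {p : OddPrio P} {v w : Value C D P} {q : ℕ}
    (h : Step (.con c p v) q w) : q = p ∧ w = v := by
  generalize hu : Value.con c p v = u at h
  cases h with
  | con c' p' v' =>
    obtain ⟨rfl, rfl, rfl⟩ := con_inj.mp hu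
    exact ⟨rfl, rfl⟩
  | record p' F x d => exact absurd hu (con_ne_record _ _ _ _ _ _)

theorem Step.of_record {p : EvenPrio P} {F : Finset D} {x : {d : D // d ∈ F} → Value C D P}
    {w : Value C D P} {q : ℕ} (h : Step (.record p F x) q w) : q = p ∧ ∃ d, w = x d := by
  generalize hu : Value.record p F x = u at h
  cases h with
  | con c' p' v' => exact absurd hu.symm (con_ne_record _ _ _ _ _ _)
  | record p' F' x' d =>
    obtain ⟨rfl, rfl⟩ := shape_eq_of_record_eq hu
    obtain ⟨-, rfl⟩ := record_inj.mp hu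
    exact ⟨rfl, d, rfl⟩

theorem isPrincipal_tail_iff {π : ℕ → ℕ} {p : ℕ} :
    IsPrincipal (fun n => π (n + 1)) p ↔ IsPrincipal π p := by
  have key : ∀ q, (∃ᶠ n in Filter.atTop, π (n + 1) = q) ↔ ∃ᶠ n in Filter.atTop, π n = q := by
    intro q
    conv_rhs => rw [← Filter.map_add_atTop_eq_nat 1]
    exact (Filter.frequently_map (m := (· + 1)) (P := fun n => π n = q)).symm
  simp only [IsPrincipal, key]

/-- A value different from `⊥` is total when all its immediate subtrees are. -/
theorem Total.of_step {v : Value C D P} (hv : v ≠ bot) (h : ∀ p w, Step v p w → w.Total) :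
    v.Total := by
  refine ⟨fun hbot => ?_, ?_⟩
  · rcases Relation.ReflTransGen.cases_head hbot with rfl | ⟨w, ⟨p, hw⟩, hbot⟩
    · exact hv rfl
    · exact (h p w hw).1 hbot
  · rintro b π rfl hb
    obtain ⟨p, hp, hπ⟩ := (h _ _ (hb 0)).2 (fun n => b (n + 1)) (fun n => π (n + 1)) rfl
      fun n => hb (n + 1)
    exact ⟨p, hp, isPrincipal_tail_iff.mp hπ⟩

theorem not_total_bot : ¬ (bot : Value C D P).Total := fun h => h.1 .refl

theorem Total.of_con {c : C} {p : OddPrio P} {v : Value C D P} (h : v.Total) :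
    (Value.con c p v).Total :=
  .of_step (con_ne_bot _ _ _) fun _ _ hs => (Step.of_con hs).2 ▸ h

theorem Total.of_record {p : EvenPrio P} {F : Finset D} {x : {d : D // d ∈ F} → Value C D P}
    (h : ∀ d, (x d).Total) : (Value.record p F x).Total :=
  .of_step (record_ne_bot _ _ _) fun q w hs => by
    obtain ⟨-, d, rfl⟩ := Step.of_record hs
    exact h d

theorem Total.step {v w : Value C D P} {p : ℕ} (h : v.Total) (hs : Step v p w) : w.Total := by
  refine ⟨fun hbot => h.1 (.head ⟨p, hs⟩ hbot), ?_⟩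
  rintro b π rfl hb
  obtain ⟨q, hq, hπ⟩ := h.2 (fun n => n.casesOn v b) (fun n => n.casesOn p π) rfl
    (fun n => by cases n with
      | zero => exact hs
      | succ n => exact hb n)
  exact ⟨q, hq, isPrincipal_tail_iff.mpr hπ⟩

/-- The record `{d = v}^p` with a single field. -/
def field (p : EvenPrio P) (d : D) (v : Value C D P) : Value C D P := record p {d} fun _ => v

/-- If `R l v`, then `l` follows `v` down to one of its subtrees, and `R` still holds there. -/
def IsBranchSimulation (R : Value C D P → Value C D P → Prop) : Prop :=
  ∀ l v, R l v →
    (l = bot ∧ v = bot) ∨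
    (∃ c p l' v', l = con c p l' ∧ v = con c p v' ∧ R l' v') ∨
    (∃ (p : EvenPrio P) (F : Finset D) (x : {d : D // d ∈ F} → Value C D P)
      (d : {d : D // d ∈ F}) (l' : Value C D P), l = field p d.1 l' ∧ v = record p F x ∧ R l' (x d))

/-- `IsBranch l v`: the value `l` is a branch of `v`, whose records are the restrictions to a single
field of those met in `v`. Coinductively, this is the greatest branch simulation. -/
def IsBranch (l v : Value C D P) : Prop := ∃ R, IsBranchSimulation R ∧ R l v

theorem IsBranch.cases {l v : Value C D P} (h : IsBranch l v) :
    (l = bot ∧ v = bot) ∨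
    (∃ c p l' v', l = con c p l' ∧ v = con c p v' ∧ IsBranch l' v') ∨
    (∃ (p : EvenPrio P) (F : Finset D) (x : {d : D // d ∈ F} → Value C D P)
      (d : {d : D // d ∈ F}) (l' : Value C D P),
      l = field p d.1 l' ∧ v = record p F x ∧ IsBranch l' (x d)) := by
  obtain ⟨R, hR, hlv⟩ := h
  rcases hR l v hlv with h | ⟨c, p, l', v', hl, hv, h⟩ | ⟨p, F, x, d, l', hl, hv, h⟩
  · exact Or.inl h
  · exact Or.inr (Or.inl ⟨c, p, l', v', hl, hv, R, hR, h⟩)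
  · exact Or.inr (Or.inr ⟨p, F, x, d, l', hl, hv, R, hR, h⟩)

theorem isBranch_bot : IsBranch (bot : Value C D P) bot :=
  ⟨fun l v => l = bot ∧ v = bot, fun _ _ h => Or.inl h, rfl, rfl⟩

theorem IsBranch.con (c : C) (p : OddPrio P) {l v : Value C D P} (h : IsBranch l v) :
    IsBranch (.con c p l) (.con c p v) := by
  refine ⟨fun a b => IsBranch a b ∨ a = .con c p l ∧ b = .con c p v, ?_, Or.inr ⟨rfl, rfl⟩⟩
  rintro a b (hab | ⟨rfl, rfl⟩)
  · rcases hab.cases with h | ⟨c, p, l', v', hl, hv, h⟩ | ⟨p, F, x, d, l', hl, hv, h⟩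
    · exact Or.inl h
    · exact Or.inr (Or.inl ⟨c, p, l', v', hl, hv, Or.inl h⟩)
    · exact Or.inr (Or.inr ⟨p, F, x, d, l', hl, hv, Or.inl h⟩)
  · exact Or.inr (Or.inl ⟨c, p, l, v, rfl, rfl, Or.inl h⟩)

theorem IsBranch.record (p : EvenPrio P) {F : Finset D} {x : {d : D // d ∈ F} → Value C D P}
    {l : Value C D P} (d : {d : D // d ∈ F}) (h : IsBranch l (x d)) :
    IsBranch (field p d.1 l) (.record p F x) := by
  refine ⟨fun a b => IsBranch a b ∨ a = field p d.1 l ∧ b = .record p F x, ?_, Or.inr ⟨rfl, rfl⟩⟩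
  rintro a b (hab | ⟨rfl, rfl⟩)
  · rcases hab.cases with h | ⟨c, p, l', v', hl, hv, h⟩ | ⟨p, F, x, d, l', hl, hv, h⟩
    · exact Or.inl h
    · exact Or.inr (Or.inl ⟨c, p, l', v', hl, hv, Or.inl h⟩)
    · exact Or.inr (Or.inr ⟨p, F, x, d, l', hl, hv, Or.inl h⟩)
  · exact Or.inr (Or.inr ⟨p, F, x, d, l, rfl, rfl, Or.inl h⟩)

/-- Every step from a branch of `v` is a step of `v`. -/
theorem IsBranch.step {l v l' : Value C D P} {p : ℕ} (h : IsBranch l v) (hs : Step l p l') :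
    ∃ v', Step v p v' ∧ IsBranch l' v' := by
  rcases h.cases with ⟨rfl, rfl⟩ | ⟨c, q, m, v', rfl, rfl, h⟩ | ⟨q, F, x, d, m, rfl, rfl, h⟩
  · generalize hb : (bot : Value C D P) = b at hs
    cases hs with
    | con => exact absurd hb.symm (con_ne_bot _ _ _)
    | record => exact absurd hb.symm (record_ne_bot _ _ _)
  · obtain ⟨rfl, rfl⟩ := hs.of_con
    exact ⟨v', .con c q v', by assumption⟩
  · obtain ⟨rfl, -, rfl⟩ := hs.of_record
    exact ⟨x d, .record q F x d, by assumption⟩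

theorem IsBranch.total {l v : Value C D P} (h : IsBranch l v) (hv : v.Total) : l.Total := by
  refine ⟨fun hbot => ?_, ?_⟩
  · obtain ⟨v', hv', hb⟩ : ∃ v', Relation.ReflTransGen (fun u w => ∃ p, Step u p w) v v' ∧
        IsBranch bot v' := by
      generalize (bot : Value C D P) = b at hbot
      induction hbot with
      | refl => exact ⟨v, .refl, h⟩
      | tail _ hs ih =>
        obtain ⟨v', hv', h'⟩ := ih
        obtain ⟨p, hs⟩ := hs
        obtain ⟨v'', hs', h''⟩ := h'.step hs
        exact ⟨v'', hv'.tail ⟨p, hs'⟩, h''⟩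
    rcases hb.cases with ⟨-, rfl⟩ | ⟨c, p, l', v', hl, -, -⟩ | ⟨p, F, x, d, l', hl, -, -⟩
    · exact hv.1 hv'
    · exact con_ne_bot _ _ _ hl.symm
    · exact record_ne_bot _ _ _ hl.symm
  · rintro b π rfl hb
    have : Nonempty (Value C D P) := ⟨bot⟩
    choose! f hf hf' using fun (n : ℕ) (v : Value C D P) (h : IsBranch (b n) v) => h.step (hb n)
    let u : ℕ → Value C D P := fun n => Nat.rec v (fun n w => f n w) n
    have hu : ∀ n, IsBranch (b n) (u n) := by
      intro n
      induction n with
      | zero => exact h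
      | succ n ih => exact hf' n _ ih
    exact hv.2 u π rfl fun n => hf n _ (hu n)

/-- A value which is not total has a branch which is not total. -/
theorem exists_bad_branch {v : Value C D P} (hv : ¬ v.Total) :
    ∃ l, IsBranch l v ∧ ¬ l.Total := by
  rw [Total, not_and_or, not_not] at hv
  rcases hv with hv | hv
  · induction hv using Relation.ReflTransGen.head_induction_on with
    | refl => exact ⟨bot, isBranch_bot, not_total_bot⟩
    | head hs _ ih =>
      obtain ⟨l, hl, hbad⟩ := ih
      obtain ⟨p, hs⟩ := hs
      cases hs with
      | con c p v => exact ⟨_, hl.con c p, fun h => hbad (h.step (.con c p l))⟩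
      | record p F x d =>
        exact ⟨_, hl.record p d, fun h =>
          hbad (h.step (.record p {d.1} (fun _ => l) ⟨d, Finset.mem_singleton_self _⟩))⟩
  · push Not at hv
    obtain ⟨b, π, rfl, hb, hπ⟩ := hv
    -- The symbols met along the branch; the record `{d = _}^p` is represented by `(p, d)`.
    have h : ∀ n, ∃ s : (C × OddPrio P) ⊕ (EvenPrio P × D),
        (∃ c p, s = .inl (c, p) ∧ b n = con c p (b (n + 1)) ∧ π n = p) ∨
        ∃ (p : EvenPrio P) (F : Finset D) (x : {d : D // d ∈ F} → Value C D P)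
          (d : {d : D // d ∈ F}),
          s = .inr (p, d.1) ∧ b n = record p F x ∧ b (n + 1) = x d ∧ π n = p := by
      intro n
      generalize b n = v, b (n + 1) = w, π n = q, hb n = hs
      cases hs with
      | con c p v => exact ⟨_, Or.inl ⟨c, p, rfl, rfl, rfl⟩⟩
      | record p F x d => exact ⟨_, Or.inr ⟨p, F, x, d, rfl, rfl, rfl, rfl⟩⟩
    choose s hs using h
    let σ : ℕ → Shape C D P := fun n => (s n).elim (fun a => .con a.1 a.2) fun a => .record a.1 {a.2}
    let l : ℕ → Value C D P := unfold σ fun n _ => n + 1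
    have hl : ∀ n, l n = node (σ n) fun _ => l (n + 1) := fun n => unfold_eq _ _ n
    have hcon : ∀ n c p, s n = .inl (c, p) → l n = con c p (l (n + 1)) := by
      intro n c p h
      have hσ : σ n = .con c p := by simp [σ, h]
      rw [hl n, hσ]
      rfl
    have hrec : ∀ n p d, s n = .inr (p, d) → l n = field p d (l (n + 1)) := by
      intro n p d h
      have hσ : σ n = .record p {d} := by simp [σ, h]
      rw [hl n, hσ]
      rfl
    refine ⟨l 0, ⟨fun m v => ∃ n, m = l n ∧ v = b n, ?_, 0, rfl, rfl⟩, fun h => ?_⟩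
    · rintro _ _ ⟨n, rfl, rfl⟩
      rcases hs n with ⟨c, p, h, hbn, -⟩ | ⟨p, F, x, d, h, hbn, hd, -⟩
      · exact Or.inr (Or.inl ⟨c, p, _, _, hcon n c p h, hbn, n + 1, rfl, rfl⟩)
      · exact Or.inr (Or.inr ⟨p, F, x, d, _, hrec n p d h, hbn, n + 1, rfl, hd.symm⟩)
    · obtain ⟨p, hp, hπp⟩ := h.2 l π rfl fun n => by
        rcases hs n with ⟨c, p, h, -, hπn⟩ | ⟨p, F, x, d, h, -, -, hπn⟩
        · rw [hcon n c p h, hπn]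
          exact .con c p _
        · rw [hrec n p d h, hπn]
          exact .record p {d.1} (fun _ => l (n + 1)) ⟨d, Finset.mem_singleton_self _⟩
      exact hπ p hp hπp

/-- `IsBadBranch l v`: the value `l` is a branch of `v` which is not total. -/
def IsBadBranch (l v : Value C D P) : Prop := IsBranch l v ∧ ¬ l.Total

theorem IsBadBranch.not_total {l v : Value C D P} (h : IsBadBranch l v) : ¬ v.Total :=
  fun hv => h.2 (h.1.total hv)

theorem IsBadBranch.con (c : C) (p : OddPrio P) {l v : Value C D P} (h : IsBadBranch l v) :
    IsBadBranch (.con c p l) (.con c p v) :=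
  ⟨h.1.con c p, fun ht => h.2 (ht.step (.con c p l))⟩

theorem IsBadBranch.record (p : EvenPrio P) {F : Finset D} {x : {d : D // d ∈ F} → Value C D P}
    {l : Value C D P} (d : {d : D // d ∈ F}) (h : IsBadBranch l (x d)) :
    IsBadBranch (field p d.1 l) (.record p F x) :=
  ⟨h.1.record p d, fun ht =>
    h.2 (ht.step (.record p {d.1} (fun _ => l) ⟨d, Finset.mem_singleton_self _⟩))⟩

theorem IsBadBranch.of_con {c : C} {p : OddPrio P} {m v : Value C D P}
    (h : IsBadBranch m (.con c p v)) : ∃ l, m = .con c p l ∧ IsBadBranch l v := by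
  obtain ⟨h, hm⟩ := h
  rcases h.cases with ⟨-, h⟩ | ⟨c', p', l, v', rfl, hv, h⟩ | ⟨q, F, x, d, l, -, hv, -⟩
  · exact absurd h (con_ne_bot _ _ _)
  · obtain ⟨rfl, rfl, rfl⟩ := con_inj.mp hv
    exact ⟨l, rfl, h, fun hl => hm hl.of_con⟩
  · exact absurd hv (con_ne_record _ _ _ _ _ _)

theorem IsBadBranch.of_record {p : EvenPrio P} {F : Finset D}
    {x : {d : D // d ∈ F} → Value C D P} {m : Value C D P} (h : IsBadBranch m (.record p F x)) :
    ∃ (d : {d : D // d ∈ F}) (l : Value C D P), m = field p d.1 l ∧ IsBadBranch l (x d) := by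
  obtain ⟨h, hm⟩ := h
  rcases h.cases with ⟨-, h⟩ | ⟨c', p', l, v', -, hv, -⟩ | ⟨q, G, y, d, l, rfl, hv, h⟩
  · exact absurd h (record_ne_bot _ _ _)
  · exact absurd hv.symm (con_ne_record _ _ _ _ _ _)
  · obtain ⟨rfl, rfl⟩ := shape_eq_of_record_eq hv
    obtain ⟨-, rfl⟩ := record_inj.mp hv
    exact ⟨d, l, rfl, h, fun hl => hm (Total.of_record fun _ => hl)⟩

end Value

/-! ### Bad branches follow the call-graph -/

open Approx Value

/-- `Factors ρ ψ U l o`: when `o = (β, u)`, the branch `l` is obtained by applying `β^⊠` to a bad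
branch of a value of `f (u U)`, where `u U` is total and `f` is interpreted by `ψ`. That `l`
belongs to `β^⊠` of some value is expressed by means of all the terms `s` that may denote it. -/
def Factors (ρ : N → Approx C D P → Approx C D P) (ψ : Approx C D P → Approx C D P)
    (U : Approx C D P) (l : Value C D P) (o : Branch C D N P × Term C D N P) : Prop :=
  (o.2.sem ρ ψ U).Total ∧ ∃ v' ∈ (ψ (o.2.sem ρ ψ U)).carrier, ∃ l', IsBadBranch l' v' ∧
    ∀ (φ : Approx C D P → Approx C D P) (s : Term C D N P),
      l' ∈ (s.sem ρ φ U).carrier → l ∈ ((Branch.app o.1.box s).sem ρ φ U).carrier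

theorem Factors.cons {ρ : N → Approx C D P → Approx C D P} {ψ : Approx C D P → Approx C D P}
    {U : Approx C D P} {l l' : Value C D P} {o : Branch C D N P × Term C D N P}
    (h : Factors ρ ψ U l' o) (a : Frame C D N P)
    (ha : ∀ (φ : Approx C D P → Approx C D P) (s : Term C D N P),
      l' ∈ (s.sem ρ φ U).carrier → l ∈ ((a.box.app s).sem ρ φ U).carrier) :
    Factors ρ ψ U l (a :: o.1, o.2) := by
  obtain ⟨htot, v', hv', m, hm, hβ⟩ := h
  exact ⟨htot, v', hv', m, hm, fun φ s hs => ha φ (Branch.app o.1.box s) (hβ φ s hs)⟩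

theorem exists_isBadBranch_of_not_total {U : Approx C D P} (h : ¬ U.Total) :
    ∃ v ∈ U.carrier, ∃ l, IsBadBranch l v := by
  simp only [Approx.Total, not_forall] at h
  obtain ⟨v, hv, hbad⟩ := h
  exact ⟨v, hv, exists_bad_branch hbad⟩

theorem mem_sem_daimon {ρ : N → Approx C D P → Approx C D P} {φ : Approx C D P → Approx C D P}
    {U : Approx C D P} (hU : U ≠ ⊤) {s : Term C D N P} {l : Value C D P}
    (h : l ∈ (s.sem ρ φ U).carrier) (m : Value C D P) :
    m ∈ ((Term.daimon 1 fun _ => s).sem ρ φ U).carrier := by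
  simp [Term.sem, hU, ne_top_of_mem h, carrier_bot]

variable [Finite C] [Finite D]

/-- A bad branch of a value of `t U`, for `U` total, factors through a recursive call whose argument
is total. Where the branch meets a function name, either this is such a call, or (the function
being total) the argument of the function is not total; in the latter case, a bad branch of the
argument is followed, and it is unrelated to the original branch, which is why the function name has
to be replaced by `⊠`. -/
theorem exists_factors {ρ : N → Approx C D P → Approx C D P} (hρ : ∀ g, TotalFun (ρ g))
    (ψ : Approx C D P → Approx C D P) {U : Approx C D P} (hU : U.Total) (hU' : U ≠ ⊤)
    {t : Term C D N P} (ht : t.DaimonFree) {v l : Value C D P}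
    (hv : v ∈ (t.sem ρ ψ U).carrier) (hl : IsBadBranch l v) :
    ∃ o ∈ t.occ, Factors ρ ψ U l o := by
  induction t generalizing v l with
  | con c p t ih =>
    obtain ⟨w, hw, rfl⟩ := mem_con.mp hv
    obtain ⟨l, rfl, hlw⟩ := hl.of_con
    obtain ⟨o, ho, h⟩ := ih ht hw hlw
    exact ⟨_, List.mem_map_of_mem ho, h.cons (.con c p) fun φ s hs => mem_con.mpr ⟨l, hs, rfl⟩⟩
  | record p F t ih =>
    simp only [Term.sem, hU', if_false] at hv
    obtain ⟨x, hx, rfl⟩ := mem_record.mp hv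
    obtain ⟨d, l, rfl, hlx⟩ := hl.of_record
    obtain ⟨o, ho, h⟩ := ih d (ht d) (hx d) hlx
    refine ⟨_, List.mem_flatMap.mpr ⟨d, by simp, List.mem_map_of_mem ho⟩,
      h.cons (.field p d) fun φ s hs => ?_⟩
    simp only [Frame.box, Frame.app, Term.sem, hU', if_false]
    exact mem_record.mpr ⟨fun _ => l, fun _ => hs, rfl⟩
  | uncon c p t ih =>
    obtain ⟨o, ho, h⟩ := ih ht (mem_uncon.mp hv) (hl.con c p)
    exact ⟨_, List.mem_map_of_mem ho, h.cons (.uncon c p) fun φ s hs => mem_uncon.mpr hs⟩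
  | proj d p t ih =>
    obtain ⟨F, x, hd, hx, rfl⟩ := mem_proj.mp hv
    obtain ⟨o, ho, h⟩ := ih ht hx (.record p ⟨d, hd⟩ hl)
    exact ⟨_, List.mem_map_of_mem ho, h.cons (.proj d p) fun φ s hs =>
      mem_proj.mpr ⟨{d}, fun _ => l, Finset.mem_singleton_self d, hs, rfl⟩⟩
  | x => exact absurd (hU v hv) hl.not_total
  | daimon n θ ih => exact ht.elim
  | call g t ih =>
    obtain ⟨w, hw, m, hm⟩ := exists_isBadBranch_of_not_total
      fun h => hl.not_total (hρ g _ h v hv)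
    obtain ⟨o, ho, h⟩ := ih ht hw hm
    exact ⟨_, List.mem_map_of_mem ho, h.cons (.call g) fun φ s hs => mem_sem_daimon hU' hs l⟩
  | self t ih =>
    by_cases htot : (t.sem ρ ψ U).Total
    · exact ⟨([], t), List.mem_cons_self, htot, v, hv, l, hl, fun φ s hs => hs⟩
    · obtain ⟨w, hw, m, hm⟩ := exists_isBadBranch_of_not_total htot
      obtain ⟨o, ho, h⟩ := ih ht hw hm
      exact ⟨_, List.mem_cons_of_mem _ (List.mem_map_of_mem ho),
        h.cons .self fun φ s hs => mem_sem_daimon hU' hs l⟩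
  | zero => exact absurd rfl (ne_top_of_mem hv)

/-- The bad branches of the values of `fix(T)` are values of all the iterates of `G(T)`. -/
theorem mem_iterate_callGraph {ρ : N → Approx C D P → Approx C D P}
    (hρ_cont : ∀ g, SeqContinuous (ρ g)) (hρ_zero : ∀ g, ρ g ⊤ = ⊤)
    (hρ_total : ∀ g, TotalFun (ρ g)) {T : List (Term C D N P)} (hT : ∀ t ∈ T, t.DaimonFree)
    (n : ℕ) {U : Approx C D P} (hU : U.Total) {v l : Value C D P}
    (hv : v ∈ (fix (semSum ρ T) U).carrier) (hl : IsBadBranch l v) :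
    l ∈ ((semSum ρ (callGraph T))^[n] daimon U).carrier := by
  have hψ : fix (semSum ρ T) ⊤ = ⊤ := fix_semSum_top hρ_zero T
  have hU' : U ≠ ⊤ := by
    rintro rfl
    exact ne_top_of_mem hv hψ
  induction n generalizing U v l with
  | zero => simp [daimon, hU', carrier_bot]
  | succ n ih =>
    obtain ⟨t, ht, hvt⟩ := mem_iInf_list.mp (semSum_fix_le hρ_cont hρ_zero hT U hv)
    obtain ⟨o, ho, htot, v', hv', l', hl', hβ⟩ :=
      exists_factors hρ_total _ hU hU' (hT t ht) hvt hl
    have hne : o.2.sem ρ (fix (semSum ρ T)) U ≠ ⊤ := fun h => by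
      rw [h, hψ] at hv'
      exact ne_top_of_mem hv' rfl
    have hl'' := ih htot hv' hl' hne
    rw [Function.iterate_succ_apply']
    refine mem_iInf_list.mpr ⟨Branch.app o.1.box (.self o.2.box),
      List.mem_flatMap.mpr ⟨t, ht, List.mem_map_of_mem ho⟩, hβ _ _ ?_⟩
    exact monotone_iterate_semSum (fun g => (hρ_cont g).mono) _ n
      (o.2.sem_box_le hρ_zero hψ _ U) hl''

end

end SizeChange

theorem mainTheorem3 {C D N : Type*} [Finite C] [Finite D] [Finite N] {P : Finset ℕ}
    (ρ : N → SizeChange.Approx C D P → SizeChange.Approx C D P)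
    (hρ_cont : ∀ g, ScottContinuous (ρ g))
    (hρ_zero : ∀ g, ρ g ⊤ = ⊤)
    (hρ_total : ∀ g, SizeChange.TotalFun (ρ g))
    (T : List (SizeChange.Term C D N P))
    (hT : ∀ t ∈ T, t.DaimonFree)
    (hG : SizeChange.TotalFun (SizeChange.fix (SizeChange.semSum ρ (SizeChange.callGraph T)))) :
    SizeChange.TotalFun (SizeChange.fix (SizeChange.semSum ρ T)) := by
  intro U hU v hv
  by_contra hbad
  obtain ⟨l, hl⟩ := SizeChange.Value.exists_bad_branch hbad
  refine hl.2 (hG U hU l ?_)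
  rw [SizeChange.fix, iSup_apply]
  exact SizeChange.Approx.mem_iSup.mpr fun n => SizeChange.mem_iterate_callGraph
    (fun g => (hρ_cont g).seqContinuous) hρ_zero hρ_total hT n hU hv hl
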